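/- Theorem 1'. Let $Z_0,Z_1,\dots$ be independent observations with common law $P$ (the law of $Z$), write $\mathcal D_n=(Z_0,\dots,Z_{n-1})$, and let $m(z,\theta)$ be a real function of an observation $z$ and of a parameter $\theta\in\Theta\subset\mathbb R^d$; $\dot m,\ddot m$ denote its gradient and Hessian in $\theta$. Put $M(\theta)=E\,m(Z,\theta)$, $M_n(\theta)=\frac1n\sum_{i<n}m(Z_i,\theta)$, $\Lambda(\theta)=E\{\dot m(Z,\theta)\dot m(Z,\theta)^{T}\}$, and let $\ddot M$ be the Hessian of $M$. Sampling with replacement. For every $n\ge1$ let $(\pi_{n,i})_{i<n}$ be positive functions of $\mathcal D_n$ with $\sum_{i<n}\pi_{n,i}=1$ almost surely. Let $s_n<n$ (for all large $n$) be integers with $s_n\to\infty$ and $s_n/n\to c$. Given $\mathcal D_n$, let the indices $I_{n,0},\dots,I_{n,s_n-1}$ be independent with $\Pr(I_{n,j}=i\mid\mathcal D_n)=\pi_{n,i}$. Let $\hat\theta_n$ be a maximizer over $\Theta$ of $M_n$, and let $\tilde\theta_{s_n,R}$ be a (measurable) maximizer over $\Theta$ of $$\theta\mapsto\sum_{j<s_n}\frac{m(Z_{I_{n,j}},\theta)}{n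 s_n\pi_{n,I_{n,j}}}.$$ Assume: 1. $\Theta$ is compact, and $\theta_0$ is an interior point of $\Theta$. 2. $m(z,\cdot)$ is concave on $\Theta$ for every $z$, $E\,m^2(Z,\theta)<\infty$ for every $\theta\in\Theta$, and $\theta_0$ is the unique maximizer of $M$ over $\Theta$. 3. $m(z,\cdot)$ is twice continuously differentiable in the interior of $\Theta$; $-E\{\ddot m(Z,\theta_0)\}$ is positive definite; $E\{\ddot m_{k,l}^2(Z,\theta)\}<\infty$ for every $\theta$ in the interior of $\Theta$ and all $k,l$; and there is a function $\psi$ with $E\psi^2(Z)<\infty$ and $|\ddot m_{k,l}(z,\theta_1)-\ddot m_{k,l}(z,\theta_2)|\le\psi(z)\|\theta_1-\theta_2\|$ for all $z$, all $\theta_1,\theta_2$ in the interior of $\Theta$ and all $k,l$. 4. $E\|\dot m(Z,\theta_0)\|^2<\infty$ and $\Lambda(\theta_0)$ is positive definite; and for some $r>0$ and each $\theta$ in the interior of $\Theta$, $\mathbf 1\{\|\theta-\hat\theta_n\|<r\}\,\frac1n\sum_{i<n}\|\dot m(Z_i,\theta)\|^4=O_P(1)$. 5. $\max_{i<n}(n\pi_{n,i})^{-1}=O_P(1)$.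 6. $\Lambda_{n,R}(\theta_0)=\frac1{n^2}\sum_{i<n}\dot m(Z_i,\theta_0)\dot m(Z_i,\theta_0)^{T}/\pi_{n,i}$ converges in probability to a (nonrandom) positive-definite matrix $\Lambda_\pi$. Then, unconditionally, as $n\to\infty$, $$\sqrt{s_n}\,(\tilde\theta_{s_n,R}-\theta_0)\rightsquigarrow N\big(0,\ \ddot M^{-1}(\theta_0)\{\Lambda_\pi+c\Lambda(\theta_0)\}\ddot M^{-1}(\theta_0)\big).$$ -/

import Mathlib

open MeasureTheory ProbabilityTheory Filter Topology

namespace Subsampling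

noncomputable section

/-- Stochastic boundedness, `X n = O_P(1)`. -/
def BoundedInProb {Ω : Type*} [MeasurableSpace Ω] (μ : Measure Ω) (X : ℕ → Ω → ℝ) : Prop :=
  ∀ ε : ℝ, 0 < ε → ∃ K : ℝ, ∀ᶠ n in atTop, μ {ω | K < |X n ω|} ≤ ENNReal.ofReal ε

/-- The Hessian matrix (all second partial derivatives) of a real function on `ℝ^d`. -/
def hessian {d : ℕ} (f : EuclideanSpace ℝ (Fin d) → ℝ) (θ : EuclideanSpace ℝ (Fin d)) :
    Matrix (Fin d) (Fin d) ℝ :=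
  Matrix.of fun k l =>
    fderiv ℝ (fderiv ℝ f) θ (EuclideanSpace.single k 1) (EuclideanSpace.single l 1)

/-- The matrix `v vᵀ` of the gradient `v` of `f` at `θ`. -/
def gradOuter {d : ℕ} (f : EuclideanSpace ℝ (Fin d) → ℝ) (θ : EuclideanSpace ℝ (Fin d)) :
    Matrix (Fin d) (Fin d) ℝ :=
  Matrix.of fun k l => gradient f θ k * gradient f θ l

section Population

variable {𝒵 : Type*} [MeasurableSpace 𝒵] {d : ℕ}

/-- The population objective `M(θ) = E m(Z, θ)`, where `Z` has law `P`. -/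
def popObj (P : Measure 𝒵) (m : 𝒵 → EuclideanSpace ℝ (Fin d) → ℝ)
    (θ : EuclideanSpace ℝ (Fin d)) : ℝ :=
  ∫ z, m z θ ∂P

/-- The expected Hessian `E m̈(Z, θ)`. -/
def expHessian (P : Measure 𝒵) (m : 𝒵 → EuclideanSpace ℝ (Fin d) → ℝ)
    (θ : EuclideanSpace ℝ (Fin d)) : Matrix (Fin d) (Fin d) ℝ :=
  Matrix.of fun k l => ∫ z, hessian (m z) θ k l ∂P

/-- The matrix `Λ(θ) = E {ṁ(Z, θ) ṁ(Z, θ)ᵀ}`. -/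
def Lam (P : Measure 𝒵) (m : 𝒵 → EuclideanSpace ℝ (Fin d) → ℝ)
    (θ : EuclideanSpace ℝ (Fin d)) : Matrix (Fin d) (Fin d) ℝ :=
  Matrix.of fun k l => ∫ z, gradOuter (m z) θ k l ∂P

end Population

section Sample

variable {Ω 𝒵 : Type*} {d : ℕ}

/-- The full-data objective `M_n(θ) = n⁻¹ ∑_{i<n} m(Z_i, θ)` (the data are `Z_0, …, Z_{n-1}`). -/
def fullObj (m : 𝒵 → EuclideanSpace ℝ (Fin d) → ℝ) (Z : ℕ → Ω → 𝒵) (n : ℕ) (ω : Ω)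
    (θ : EuclideanSpace ℝ (Fin d)) : ℝ :=
  (n : ℝ)⁻¹ * ∑ i ∈ Finset.range n, m (Z i ω) θ

/-- The subsample objective `∑_{j<s} m(Z_{I_j}, θ) / (n s π_{n, I_j})`, where
`I_0, …, I_{s-1}` are the selected indices. -/
def subObj (m : 𝒵 → EuclideanSpace ℝ (Fin d) → ℝ) (Z : ℕ → Ω → 𝒵) (π : ℕ → ℕ → Ω → ℝ)
    (s : ℕ → ℕ) (I : (n : ℕ) → Fin (s n) → Ω → ℕ) (n : ℕ) (ω : Ω)
    (θ : EuclideanSpace ℝ (Fin d)) : ℝ :=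
  ∑ j : Fin (s n), m (Z (I n j ω) ω) θ / ((n : ℝ) * (s n : ℝ) * π n (I n j ω) ω)

/-- `Λ_{n,R}(θ) = n⁻² ∑_{i<n} ṁ(Z_i, θ) ṁ(Z_i, θ)ᵀ / π_{n,i}`. -/
def LamR (m : 𝒵 → EuclideanSpace ℝ (Fin d) → ℝ) (Z : ℕ → Ω → 𝒵) (π : ℕ → ℕ → Ω → ℝ)
    (n : ℕ) (ω : Ω) (θ : EuclideanSpace ℝ (Fin d)) : Matrix (Fin d) (Fin d) ℝ :=
  Matrix.of fun k l =>
    ((n : ℝ) ^ 2)⁻¹ * ∑ i ∈ Finset.range n, gradOuter (m (Z i ω)) θ k l / π n i ω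

/-- `n⁻¹ ∑_{i<n} ‖ṁ(Z_i, θ)‖⁴`. -/
def gradFourth (m : 𝒵 → EuclideanSpace ℝ (Fin d) → ℝ) (Z : ℕ → Ω → 𝒵) (n : ℕ) (ω : Ω)
    (θ : EuclideanSpace ℝ (Fin d)) : ℝ :=
  (n : ℝ)⁻¹ * ∑ i ∈ Finset.range n, ‖gradient (m (Z i ω)) θ‖ ^ 4

/-- The σ-algebra of the full data `D_n = (Z_0, …, Z_{n-1})`. -/
abbrev dataSigma [MeasurableSpace 𝒵] (Z : ℕ → Ω → 𝒵) (n : ℕ) : MeasurableSpace Ω :=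
  MeasurableSpace.comap (fun ω (i : Fin n) => Z i ω) inferInstance

/-- `π_{n,0}, …, π_{n,n-1}` is, for every `n ≥ 1`, a subsampling distribution computed from the
full data: it is a function of `D_n`, positive, and sums to one. -/
structure IsSubsamplingDistribution [MeasurableSpace Ω] [MeasurableSpace 𝒵] (μ : Measure Ω)
    (Z : ℕ → Ω → 𝒵) (π : ℕ → ℕ → Ω → ℝ) : Prop where
  measurable : ∀ n, ∀ i < n, Measurable[dataSigma Z n] (π n i)
  pos : ∀ n, ∀ i < n, ∀ᵐ ω ∂μ, 0 < π n i ω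
  sum_eq_one : ∀ n, 1 ≤ n → ∀ᵐ ω ∂μ, ∑ i ∈ Finset.range n, π n i ω = 1

/-- Sampling with replacement: given the full data `D_n`, the indices `I n 0, …, I n (s n - 1)` are
independent, each equal to `i` with probability `π_{n,i}`. -/
structure IsSampledWithReplacement [MeasurableSpace Ω] [MeasurableSpace 𝒵] (μ : Measure Ω)
    (Z : ℕ → Ω → 𝒵) (π : ℕ → ℕ → Ω → ℝ) (s : ℕ → ℕ) (I : (n : ℕ) → Fin (s n) → Ω → ℕ) :
    Prop where
  measurable : ∀ n j, Measurable (I n j)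
  condProb : ∀ n (a : Fin (s n) → ℕ), (∀ j, a j < n) →
    μ[Set.indicator {ω | ∀ j, I n j ω = a j} (fun _ => (1 : ℝ)) | dataSigma Z n]
      =ᵐ[μ] fun ω => ∏ j, π n (a j) ω

end Sample

end

end Subsampling

open Subsampling

/-! Given the data, a weighted sum over the draws is a sum of i.i.d. terms, so its characteristic
function is the expectation of `φ ^ s n`, where `φ` is a `π`-weighted average of exponentials over
the data. The elementary bound `norm_pow_sub_exp_le` replaces `φ ^ s n` by the exponential of a
data-measurable exponent (`tendsto_integral_exp_draws_sub`). For the score in direction `t`, put f =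
⟨ṁ(·, θ₀), t⟩ and v = tᵀ Λπ t. The exponent is then i √s times the full-data mean of f, minus v/2.
The second term is the noise of the resampling. The first term is the noise of the data: the
full-data mean of f is of size n^(-1/2), and since s/n → c it contributes the variance c E f². The
two variances add up to tᵀ(Λπ + cΛ(θ₀))t.

The Taylor remainder is a Lindeberg term. On the event max (nπ)⁻¹ ≤ K it is at most a constant times
the full-data mean of f² min(1, K s^(-1/2)|f|), whose expectation vanishes by dominated convergence.
The same comparison carried to first order gives a weak law for weighted subsample means of
square-integrable functions. That law is applied to the Hessian entries at θ₀ and to |ψ|.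

The passage from score to estimator is deterministic and rests on concavity (`norm_argmax_sub_le`).
If the gradient at θ₀ is small and the Hessian there is close to a negative definite form, the
radial derivative is negative on a small sphere around θ₀, so no maximizer lies on or beyond it.
This gives localization without a uniform law of large numbers. The gradient vanishes at the
maximizer, and expanding it gives the Newton step up to an error of smaller order. Hence √s(θ̃ - θ₀)
equals minus the inverse Hessian applied to the score, up to o_P(1), and Slutsky's theorem
concludes. Differentiation under the integral identifies the Hessian of M with the expected Hessian
and shows that the score is centred. -/

namespace Subsampling

/-! ### Calculus of o_P(1) and O_P(1), and its links with convergence in law. -/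

section InMeasure

variable {Ω : Type*} [MeasurableSpace Ω] {μ : Measure Ω}

theorem tendstoInMeasure_zero_iff {E : Type*} [SeminormedAddCommGroup E] {f : ℕ → Ω → E} :
    TendstoInMeasure μ f atTop (fun _ => 0) ↔
      ∀ ε : ℝ, 0 < ε → Tendsto (fun n => μ {ω | ε ≤ ‖f n ω‖}) atTop (𝓝 0) := by
  simp [tendstoInMeasure_iff_norm]

theorem tendstoInMeasure_sub_const_iff {E : Type*} [SeminormedAddCommGroup E] {f : ℕ → Ω → E}
    {a : E} : TendstoInMeasure μ (fun n ω => f n ω - a) atTop (fun _ => 0) ↔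
      TendstoInMeasure μ f atTop (fun _ => a) := by
  simp [tendstoInMeasure_iff_norm]

theorem _root_.MeasureTheory.TendstoInMeasure.zero_of_le {E F : Type*} [SeminormedAddCommGroup E]
    [SeminormedAddCommGroup F] {f : ℕ → Ω → E} {g : ℕ → Ω → F}
    (hg : TendstoInMeasure μ g atTop (fun _ => 0))
    (h : ∀ᶠ n in atTop, ∀ᵐ ω ∂μ, ‖f n ω‖ ≤ ‖g n ω‖) :
    TendstoInMeasure μ f atTop (fun _ => 0) := by
  rw [tendstoInMeasure_zero_iff] at hg ⊢
  intro ε hε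
  refine tendsto_of_tendsto_of_tendsto_of_le_of_le' tendsto_const_nhds (hg ε hε)
    (Eventually.of_forall fun _ => zero_le) ?_
  filter_upwards [h] with n hn
  refine measure_mono_ae ?_
  filter_upwards [hn] with ω hω h1
  exact le_trans (show ε ≤ ‖f n ω‖ from h1) hω

theorem _root_.MeasureTheory.TendstoInMeasure.zero_norm {E : Type*} [SeminormedAddCommGroup E] {f : ℕ → Ω → E}
    (hf : TendstoInMeasure μ f atTop (fun _ => 0)) :
    TendstoInMeasure μ (fun n ω => ‖f n ω‖) atTop (fun _ => 0) :=
  hf.zero_of_le (Eventually.of_forall fun n => ae_of_all _ fun ω => by simp)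

theorem _root_.MeasureTheory.TendstoInMeasure.zero_add {E : Type*} [SeminormedAddCommGroup E] {f g : ℕ → Ω → E}
    (hf : TendstoInMeasure μ f atTop (fun _ => 0)) (hg : TendstoInMeasure μ g atTop (fun _ => 0)) :
    TendstoInMeasure μ (fun n ω => f n ω + g n ω) atTop (fun _ => 0) := by
  rw [tendstoInMeasure_zero_iff] at hf hg ⊢
  intro ε hε
  have := (hf (ε / 2) (by positivity)).add (hg (ε / 2) (by positivity))
  rw [add_zero] at this
  refine tendsto_of_tendsto_of_tendsto_of_le_of_le tendsto_const_nhds this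
    (fun _ => zero_le) fun n => ?_
  refine (measure_mono ?_).trans (measure_union_le _ _)
  intro ω hω
  by_contra hcon
  simp only [Set.mem_union, Set.mem_ofPred_eq, not_or, not_le] at hcon hω
  have := norm_add_le (f n ω) (g n ω)
  linarith

theorem _root_.MeasureTheory.TendstoInMeasure.zero_sum {E ι : Type*} [SeminormedAddCommGroup E] (t : Finset ι)
    {f : ι → ℕ → Ω → E} (hf : ∀ i ∈ t, TendstoInMeasure μ (f i) atTop (fun _ => 0)) :
    TendstoInMeasure μ (fun n ω => ∑ i ∈ t, f i n ω) atTop (fun _ => 0) := by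
  classical
  induction t using Finset.induction_on with
  | empty =>
    rw [tendstoInMeasure_zero_iff]
    intro ε hε
    simp [not_le.2 hε]
  | insert i t hi ih =>
    simp only [Finset.sum_insert hi]
    exact (hf i (by simp)).zero_add (ih fun j hj => hf j (by simp [hj]))

/-- A statement about the small values of a stochastically bounded sequence suffices. -/
theorem _root_.MeasureTheory.TendstoInMeasure.zero_of_boundedInProb {E : Type*} [SeminormedAddCommGroup E]
    {f : ℕ → Ω → E} {W : ℕ → Ω → ℝ} (hW : BoundedInProb μ W)
    (h : ∀ K : ℝ, 0 < K → ∃ g : ℕ → Ω → ℝ, TendstoInMeasure μ g atTop (fun _ => 0) ∧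
      ∀ᶠ n in atTop, ∀ᵐ ω ∂μ, |W n ω| ≤ K → ‖f n ω‖ ≤ ‖g n ω‖) :
    TendstoInMeasure μ f atTop (fun _ => 0) := by
  rw [tendstoInMeasure_zero_iff]
  intro ε hε
  rw [ENNReal.tendsto_nhds_zero]
  intro δ hδ
  obtain ⟨η, hη, hηδ⟩ : ∃ η : ℝ, 0 < η ∧ ENNReal.ofReal η + ENNReal.ofReal η ≤ δ := by
    rcases eq_or_ne δ ⊤ with rfl | hδ'
    · exact ⟨1, one_pos, le_top⟩
    · have hpos := ENNReal.toReal_pos hδ.ne' hδ'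
      refine ⟨δ.toReal / 2, by positivity, ?_⟩
      rw [← ENNReal.ofReal_add (by positivity) (by positivity), add_halves,
        ENNReal.ofReal_toReal hδ']
  obtain ⟨K, hK⟩ := hW η hη
  obtain ⟨g, hg, hfg⟩ := h (max K 1) (by positivity)
  rw [tendstoInMeasure_zero_iff] at hg
  have h1 := ENNReal.tendsto_nhds_zero.1 (hg ε hε) (ENNReal.ofReal η) (by simpa using hη)
  filter_upwards [h1, hK, hfg] with n h1 h2 h3
  refine le_trans ?_ hηδ
  refine le_trans ?_ (add_le_add h2 h1)
  refine le_trans (measure_mono_ae ?_) (measure_union_le _ _)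
  filter_upwards [h3] with ω hω hf
  by_cases hKω : |W n ω| ≤ max K 1
  · exact Or.inr (le_trans (show ε ≤ ‖f n ω‖ from hf) (hω hKω))
  · exact Or.inl (show K < |W n ω| from lt_of_le_of_lt (le_max_left _ _) (not_le.1 hKω))

theorem _root_.MeasureTheory.TendstoInMeasure.zero_const_smul {E : Type*} [SeminormedAddCommGroup E] [NormedSpace ℝ E]
    {f : ℕ → Ω → E} (a : ℝ) (hf : TendstoInMeasure μ f atTop (fun _ => 0)) :
    TendstoInMeasure μ (fun n ω => a • f n ω) atTop (fun _ => 0) := by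
  rw [tendstoInMeasure_zero_iff] at hf ⊢
  intro ε hε
  refine tendsto_of_tendsto_of_tendsto_of_le_of_le tendsto_const_nhds
    (hf (ε / (|a| + 1)) (by positivity)) (fun _ => zero_le) fun n => ?_
  refine measure_mono fun ω hω => ?_
  simp only [Set.mem_ofPred_eq, norm_smul, Real.norm_eq_abs] at hω ⊢
  rw [div_le_iff₀ (by positivity)]
  nlinarith [norm_nonneg (f n ω)]

theorem _root_.MeasureTheory.TendstoInMeasure.zero_boundedInProb_mul {W f : ℕ → Ω → ℝ} (hW : BoundedInProb μ W)
    (hf : TendstoInMeasure μ f atTop (fun _ => 0)) :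
    TendstoInMeasure μ (fun n ω => W n ω * f n ω) atTop (fun _ => 0) := by
  refine TendstoInMeasure.zero_of_boundedInProb hW fun K hK => ⟨_, hf.zero_const_smul K, ?_⟩
  refine Eventually.of_forall fun n => ae_of_all _ fun ω hω => ?_
  simp only [norm_mul, norm_smul, Real.norm_eq_abs, abs_of_pos hK]
  gcongr

theorem tendstoInMeasure_zero_of_tendsto {E : Type*} [SeminormedAddCommGroup E] {a : ℕ → E}
    (h : Tendsto a atTop (𝓝 0)) : TendstoInMeasure μ (fun n (_ : Ω) => a n) atTop (fun _ => 0) := by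
  rw [tendstoInMeasure_zero_iff]
  intro ε hε
  refine tendsto_nhds_of_eventually_eq ?_
  have := (tendsto_zero_iff_norm_tendsto_zero.1 h).eventually (gt_mem_nhds hε)
  filter_upwards [this] with n hn
  simp [not_le.2 hn]

theorem _root_.MeasureTheory.TendstoInMeasure.zero_tendsto_smul {E : Type*} [SeminormedAddCommGroup E] [NormedSpace ℝ E]
    {f : ℕ → Ω → E} {a : ℕ → ℝ} {b : ℝ} (ha : Tendsto a atTop (𝓝 b))
    (hf : TendstoInMeasure μ f atTop (fun _ => 0)) :
    TendstoInMeasure μ (fun n ω => a n • f n ω) atTop (fun _ => 0) := by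
  refine (hf.zero_const_smul (|b| + 1)).zero_of_le ?_
  filter_upwards [ha.abs.eventually (gt_mem_nhds (lt_add_one |b|))] with n hn
  refine ae_of_all _ fun ω => ?_
  simp only [norm_smul, Real.norm_eq_abs]
  rw [abs_of_pos (show 0 < |b| + 1 by positivity)]
  gcongr

theorem _root_.MeasureTheory.TendstoInMeasure.zero_smul_of_const {E : Type*} [SeminormedAddCommGroup E] [NormedSpace ℝ E]
    {f : ℕ → Ω → E} {e : E} {a : ℕ → ℝ} (ha : Tendsto a atTop (𝓝 0))
    (hf : TendstoInMeasure μ f atTop (fun _ => e)) :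
    TendstoInMeasure μ (fun n ω => a n • f n ω) atTop (fun _ => 0) := by
  have h1 := (tendstoInMeasure_sub_const_iff.2 hf).zero_tendsto_smul ha
  have h2 : TendstoInMeasure μ (fun n (_ : Ω) => a n • e) atTop (fun _ => 0) :=
    tendstoInMeasure_zero_of_tendsto (by simpa using ha.smul_const e)
  refine (h1.zero_add h2).congr_left fun n => ae_of_all _ fun ω => by simp [smul_sub]

theorem tendstoInMeasure_zero_of_lintegral [IsFiniteMeasure μ] {f : ℕ → Ω → ℝ}
    (hf : ∀ n, AEMeasurable (f n) μ)
    (h : Tendsto (fun n => ∫⁻ ω, ENNReal.ofReal ‖f n ω‖ ∂μ) atTop (𝓝 0)) :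
    TendstoInMeasure μ f atTop (fun _ => 0) := by
  rw [tendstoInMeasure_zero_iff]
  intro ε hε
  have h1 : Tendsto (fun n => (∫⁻ ω, ENNReal.ofReal ‖f n ω‖ ∂μ) / ENNReal.ofReal ε) atTop
      (𝓝 0) := by
    simpa using ENNReal.Tendsto.div_const h (Or.inr (by simpa using hε))
  refine tendsto_of_tendsto_of_tendsto_of_le_of_le tendsto_const_nhds h1
    (fun _ => zero_le) fun n => ?_
  refine le_trans (measure_mono ?_) (meas_ge_le_lintegral_div (by fun_prop)
    (by simpa using hε) (by simp))
  intro ω hω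
  exact ENNReal.ofReal_le_ofReal hω

/-- Bounded convergence: every subsequence has a further subsequence converging almost everywhere,
to which dominated convergence applies. -/
theorem _root_.MeasureTheory.TendstoInMeasure.tendsto_integral_zero [IsProbabilityMeasure μ] {E : Type*}
    [NormedAddCommGroup E] [NormedSpace ℝ E] {f : ℕ → Ω → E} {C : ℝ}
    (hbd : ∀ n, ∀ᵐ ω ∂μ, ‖f n ω‖ ≤ C) (hm : ∀ n, AEStronglyMeasurable (f n) μ)
    (hf : TendstoInMeasure μ f atTop (fun _ => 0)) :
    Tendsto (fun n => ∫ ω, f n ω ∂μ) atTop (𝓝 0) := by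
  refine tendsto_of_subseq_tendsto fun ns hns => ?_
  obtain ⟨ms, -, hms⟩ := (hf.comp hns).exists_seq_tendsto_ae
  refine ⟨ms, ?_⟩
  rw [show (0 : E) = ∫ _, (0 : E) ∂μ by simp]
  refine tendsto_integral_of_dominated_convergence (fun _ => C) (fun n => hm _) (by simp)
    (fun n => hbd _) ?_
  filter_upwards [hms] with ω hω using hω

/-- The limit law gives the closed sets {K ≤ ‖x‖} arbitrarily small mass as K grows, and the
portmanteau theorem transfers this to the sequence. -/
theorem boundedInProb_of_tendstoInDistribution [IsProbabilityMeasure μ] {E Ω' : Type*}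
    [NormedAddCommGroup E] [MeasurableSpace E] [BorelSpace E] [MeasurableSpace Ω'] {μ' : Measure Ω'}
    [IsProbabilityMeasure μ'] {V : ℕ → Ω → E} {Y : Ω' → E}
    (h : TendstoInDistribution V atTop Y (fun _ => μ) μ') :
    BoundedInProb μ fun n ω => ‖V n ω‖ := by
  intro ε hε
  have hY := h.aemeasurable_limit
  have hlim : Tendsto (fun K : ℕ => μ'.map Y {x | (K : ℝ) ≤ ‖x‖}) atTop (𝓝 0) := by
    have : Tendsto (fun K : ℕ => μ'.map Y {x | (K : ℝ) ≤ ‖x‖}) atTop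
        (𝓝 (μ'.map Y (⋂ K : ℕ, {x | (K : ℝ) ≤ ‖x‖}))) := by
      have := Measure.isProbabilityMeasure_map hY
      refine tendsto_measure_iInter_atTop
        (fun K => (measurableSet_le measurable_const measurable_norm).nullMeasurableSet) ?_
        ⟨0, measure_ne_top _ _⟩
      intro a b hab x hx
      exact le_trans (show (a : ℝ) ≤ b by exact_mod_cast hab) (show (b : ℝ) ≤ ‖x‖ from hx)
    convert this
    symm
    convert measure_empty (μ := μ'.map Y)
    ext x
    simp only [Set.mem_iInter, Set.mem_ofPred_eq, Set.mem_empty_iff_false, iff_false, not_forall,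
      not_le]
    exact exists_nat_gt _
  obtain ⟨K, hK⟩ := (hlim.eventually (gt_mem_nhds (ENNReal.ofReal_pos.2 hε))).exists
  refine ⟨K, ?_⟩
  have hcl : IsClosed {x : E | (K : ℝ) ≤ ‖x‖} := isClosed_le continuous_const continuous_norm
  have h1 := ProbabilityMeasure.limsup_measure_closed_le_of_tendsto h.tendsto hcl
  have h2 := eventually_lt_of_limsup_lt (lt_of_le_of_lt h1 hK)
  filter_upwards [h2] with n hn
  refine le_trans ?_ hn.le
  simp only [ProbabilityMeasure.coe_mk]
  rw [Measure.map_apply_of_aemeasurable (h.forall_aemeasurable n) hcl.measurableSet]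
  refine measure_mono fun ω hω => ?_
  simp only [Set.mem_ofPred_eq, abs_norm, Set.mem_preimage] at hω ⊢
  exact hω.le

/-- The portmanteau theorem applied to the complement of an open ball around `a`, which is null for
the Dirac mass. -/
theorem tendstoInMeasure_of_tendstoInDistribution_const [IsProbabilityMeasure μ] {E Ω' : Type*}
    [NormedAddCommGroup E] [MeasurableSpace E] [BorelSpace E] [MeasurableSpace Ω'] {μ' : Measure Ω'}
    [IsProbabilityMeasure μ'] {V : ℕ → Ω → E} {a : E}
    (h : TendstoInDistribution V atTop (fun _ => a) (fun _ => μ) μ') :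
    TendstoInMeasure μ V atTop (fun _ => a) := by
  rw [tendstoInMeasure_iff_norm]
  intro ε hε
  have hcl : IsClosed {x : E | ε ≤ ‖x - a‖} := isClosed_le continuous_const (by fun_prop)
  have h1 := ProbabilityMeasure.limsup_measure_closed_le_of_tendsto h.tendsto hcl
  have h0 : μ'.map (fun _ => a) {x : E | ε ≤ ‖x - a‖} = 0 := by
    rw [Measure.map_apply measurable_const hcl.measurableSet]
    simp [not_le.2 hε]
  rw [ENNReal.tendsto_nhds_zero]
  intro δ hδ
  have h2 := eventually_lt_of_limsup_lt (lt_of_le_of_lt (h1.trans h0.le) hδ)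
  filter_upwards [h2] with n hn
  simp only [ProbabilityMeasure.coe_mk] at hn
  rw [Measure.map_apply_of_aemeasurable (h.forall_aemeasurable n) hcl.measurableSet] at hn
  exact hn.le

/-- Lévy's continuity theorem for random vectors. -/
theorem tendstoInDistribution_of_charFun [IsProbabilityMeasure μ] {E : Type*}
    [NormedAddCommGroup E] [InnerProductSpace ℝ E] [FiniteDimensional ℝ E]
    [MeasurableSpace E] [BorelSpace E] {ν : Measure E} [IsProbabilityMeasure ν] {V : ℕ → Ω → E}
    (hV : ∀ n, AEMeasurable (V n) μ)
    (h : ∀ t : E, Tendsto (fun n => ∫ ω, Complex.exp (inner ℝ (V n ω) t * Complex.I) ∂μ) atTop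
      (𝓝 (charFun ν t))) :
    TendstoInDistribution V atTop (id : E → E) (fun _ => μ) ν where
  forall_aemeasurable := hV
  aemeasurable_limit := aemeasurable_id
  tendsto := by
    refine ProbabilityMeasure.tendsto_iff_tendsto_charFun.2 fun t => ?_
    simp only [ProbabilityMeasure.coe_mk, Measure.map_id]
    refine (h t).congr fun n => ?_
    rw [charFun_apply, integral_map (hV n) (by fun_prop)]

end InMeasure

/-! ### Estimates for the complex exponential and for powers close to exponentials. -/

section ComplexExp

theorem norm_exp_mul_I_sub_taylor_one_le (x : ℝ) :
    ‖Complex.exp (x * Complex.I) - 1 - x * Complex.I‖ ≤ 3 * x ^ 2 := by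
  rcases le_or_gt |x| 1 with h | h
  · refine (Complex.norm_exp_sub_one_sub_id_le (x := x * Complex.I) (by simpa using h)).trans ?_
    simp only [norm_mul, Complex.norm_real, Complex.norm_I, mul_one, Real.norm_eq_abs, sq_abs]
    nlinarith [sq_nonneg x]
  · have h1 : ‖Complex.exp (x * Complex.I) - 1 - x * Complex.I‖ ≤ 1 + 1 + |x| := by
      refine (norm_sub_le _ _).trans (add_le_add ((norm_sub_le _ _).trans ?_) (by simp))
      simp [Complex.norm_exp_ofReal_mul_I]
    rw [← sq_abs x]
    nlinarith

/-- The remainder is cubic for small `x` and quadratic for large `x`. The factor `min 1 |x|` records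
both, so that second moments suffice in the Lindeberg argument. -/
theorem norm_exp_mul_I_sub_taylor_two_le (x : ℝ) :
    ‖Complex.exp (x * Complex.I) - 1 - x * Complex.I + (x : ℂ) ^ 2 / 2‖
      ≤ 4 * (x ^ 2 * min 1 |x|) := by
  rcases le_or_gt |x| 1 with h | h
  · have := Complex.exp_bound (x := x * Complex.I) (by simpa using h) (n := 3) (by norm_num)
    simp only [Finset.sum_range_succ, Finset.sum_range_zero] at this
    rw [min_eq_right h]
    norm_num [Nat.factorial] at this
    have e : Complex.exp (x * Complex.I) - 1 - x * Complex.I + (x : ℂ) ^ 2 / 2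
      = Complex.exp (x * Complex.I) - (1 + x * Complex.I + (x * Complex.I) ^ 2 / 2) := by
      rw [mul_pow, Complex.I_sq]; ring
    rw [e]
    refine this.trans ?_
    rw [← sq_abs x]
    nlinarith [pow_nonneg (abs_nonneg x) 3]
  · rw [min_eq_left h.le]
    have h1 : ‖Complex.exp (x * Complex.I) - 1 - x * Complex.I + (x : ℂ) ^ 2 / 2‖
        ≤ 1 + 1 + |x| + x ^ 2 / 2 := by
      refine (norm_add_le _ _).trans (add_le_add ((norm_sub_le _ _).trans
        (add_le_add ((norm_sub_le _ _).trans ?_) (by simp))) (by simp))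
      simp [Complex.norm_exp_ofReal_mul_I]
    rw [← sq_abs x] at *
    nlinarith

theorem norm_pow_sub_pow_le {a b : ℂ} (ha : ‖a‖ ≤ 1) (hb : ‖b‖ ≤ 1) (k : ℕ) :
    ‖a ^ k - b ^ k‖ ≤ k * ‖a - b‖ := by
  induction k with
  | zero => simp
  | succ k ih =>
    have e : a ^ (k + 1) - b ^ (k + 1) = a * (a ^ k - b ^ k) + (a - b) * b ^ k := by ring
    rw [e]
    refine (norm_add_le _ _).trans ?_
    rw [norm_mul, norm_mul, norm_pow]
    have h1 : ‖a‖ * ‖a ^ k - b ^ k‖ ≤ 1 * (k * ‖a - b‖) := by gcongr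
    have h2 : ‖a - b‖ * ‖b‖ ^ k ≤ ‖a - b‖ * 1 := by
      gcongr
      exact pow_le_one₀ (norm_nonneg _) hb
    push_cast
    linarith

theorem norm_exp_sub_exp_le {a b : ℂ} (ha : a.re ≤ 0) (hb : b.re ≤ 0) :
    ‖Complex.exp a - Complex.exp b‖ ≤ ‖a - b‖ := by
  have h := Convex.norm_image_sub_le_of_norm_deriv_le (𝕜 := ℂ) (f := Complex.exp) (C := 1)
    (s := {z : ℂ | z.re ≤ 0}) (x := b) (y := a)
    (fun x _ => Complex.differentiableAt_exp) (fun x hx => by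
      rw [Complex.deriv_exp, Complex.norm_exp]
      exact Real.exp_le_one_iff.2 hx) (convex_halfSpace_re_le 0) hb ha
  simpa using h

/-- Replace `φ` by `exp (φ - 1)`, at a quadratic cost per factor. Powers in the unit disc lose only
a factor `k`, and `exp` is 1-Lipschitz on the left half-plane. No complex logarithm is involved. -/
theorem norm_pow_sub_exp_le {φ c : ℂ} (hφ : ‖φ‖ ≤ 1) (hc : c.re ≤ 0) (k : ℕ) :
    ‖φ ^ k - Complex.exp c‖ ≤ 2 * (k * ‖φ - 1‖ ^ 2) + ‖k * (φ - 1) - c‖ := by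
  have hre : (φ - 1).re ≤ 0 := by
    have := (Complex.re_le_norm φ).trans hφ
    simp only [Complex.sub_re, Complex.one_re]
    linarith
  have he : ‖Complex.exp (φ - 1)‖ ≤ 1 := by
    rw [Complex.norm_exp]
    exact Real.exp_le_one_iff.2 hre
  have h1 : ‖φ - Complex.exp (φ - 1)‖ ≤ 2 * ‖φ - 1‖ ^ 2 := by
    -- Near 1 this is the Taylor bound for `exp`. Otherwise both points lie in the unit disc, at
    -- distance at most 2 ≤ 2‖φ - 1‖².
    rcases le_or_gt ‖φ - 1‖ 1 with h | h
    · have := Complex.norm_exp_sub_one_sub_id_le h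
      rw [← norm_neg] at this
      have e : -(Complex.exp (φ - 1) - 1 - (φ - 1)) = φ - Complex.exp (φ - 1) := by ring
      rw [e] at this
      nlinarith [norm_nonneg (φ - 1)]
    · have := norm_sub_le φ (Complex.exp (φ - 1))
      nlinarith
  have h2 := norm_pow_sub_pow_le hφ he k
  have h3 : ‖Complex.exp (φ - 1) ^ k - Complex.exp c‖ ≤ ‖k * (φ - 1) - c‖ := by
    rw [← Complex.exp_nat_mul]
    refine norm_exp_sub_exp_le ?_ hc
    rw [← Complex.ofReal_natCast, Complex.re_ofReal_mul]
    exact mul_nonpos_of_nonneg_of_nonpos (by positivity) hre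
  calc ‖φ ^ k - Complex.exp c‖
      ≤ ‖φ ^ k - Complex.exp (φ - 1) ^ k‖ + ‖Complex.exp (φ - 1) ^ k - Complex.exp c‖ :=
        norm_sub_le_norm_sub_add_norm_sub _ _ _
    _ ≤ k * (2 * ‖φ - 1‖ ^ 2) + ‖k * (φ - 1) - c‖ := by
        refine add_le_add (h2.trans ?_) h3
        gcongr
    _ = _ := by ring

end ComplexExp

/-! ### Sampling with replacement: the joint law of the draws given the data. -/

section Draws

variable {Ω 𝒵 : Type*} [MeasurableSpace Ω] [MeasurableSpace 𝒵] {μ : Measure Ω}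
  [IsProbabilityMeasure μ] {Z : ℕ → Ω → 𝒵} {π : ℕ → ℕ → Ω → ℝ} {s : ℕ → ℕ}
  {I : (n : ℕ) → Fin (s n) → Ω → ℕ} {n : ℕ}

omit [MeasurableSpace Ω] in
theorem measurable_dataSigma {i : ℕ} (hi : i < n) : Measurable[dataSigma Z n] (Z i) := by
  have h : Measurable[dataSigma Z n] (fun ω (i : Fin n) => Z i ω) := comap_measurable _
  exact (measurable_pi_apply (⟨i, hi⟩ : Fin n)).comp h

theorem dataSigma_le (hZ : ∀ i, Measurable (Z i)) (n : ℕ) : dataSigma Z n ≤ ‹MeasurableSpace Ω› :=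
  Measurable.comap_le (measurable_pi_lambda _ fun i => hZ i)

omit [IsProbabilityMeasure μ] in
theorem measurableSet_draws (hI : IsSampledWithReplacement μ Z π s I) (a : Fin (s n) → ℕ) :
    MeasurableSet {ω | ∀ j, I n j ω = a j} := by
  rw [show {ω | ∀ j, I n j ω = a j} = ⋂ j, I n j ⁻¹' {a j} by ext; simp]
  exact MeasurableSet.iInter fun j => hI.measurable n j (measurableSet_singleton _)

/-- A data-measurable factor can be pulled out of the conditional expectation that defines the
sampling scheme. This is how the conditional law of the draws enters. -/
theorem integral_indicator_draws_smul (hZ : ∀ i, Measurable (Z i))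
    (hI : IsSampledWithReplacement μ Z π s I) {a : Fin (s n) → ℕ} (ha : ∀ j, a j < n)
    {G : Ω → ℂ} (hG : StronglyMeasurable[dataSigma Z n] G) (hG1 : ∀ ω, ‖G ω‖ ≤ 1) :
    Integrable (fun ω => (∏ j, π n (a j) ω) • G ω) μ ∧
    Integrable (fun ω => {ω | ∀ j, I n j ω = a j}.indicator (fun _ => (1 : ℝ)) ω • G ω) μ ∧
    ∫ ω, {ω | ∀ j, I n j ω = a j}.indicator (fun _ => (1 : ℝ)) ω • G ω ∂μ
      = ∫ ω, (∏ j, π n (a j) ω) • G ω ∂μ := by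
  set A : Ω → ℝ := {ω | ∀ j, I n j ω = a j}.indicator (fun _ => (1 : ℝ)) with hA
  have hm := dataSigma_le hZ n
  have hAint : Integrable A μ := (integrable_const _).indicator (measurableSet_draws hI a)
  have hGm : AEStronglyMeasurable G μ := (hG.mono hm).aestronglyMeasurable
  have hAG : Integrable (A • G) μ := by
    refine hAint.smul_bdd 1 hGm (ae_of_all _ hG1)
  have hc := hI.condProb n a ha
  have hcond := condExp_smul_of_aestronglyMeasurable_right (m := dataSigma Z n) hAint hAG
    hG.aestronglyMeasurable
  have hint : Integrable (fun ω => (∏ j, π n (a j) ω) • G ω) μ :=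
    (integrable_condExp (m := dataSigma Z n) (f := A)).congr hc |>.smul_bdd 1 hGm (ae_of_all _ hG1)
  refine ⟨hint, hAG, ?_⟩
  change ∫ ω, (A • G) ω ∂μ = _
  rw [← integral_condExp hm]
  refine integral_congr_ae ?_
  filter_upwards [hcond, hc] with ω h1 h2
  rw [h1, Pi.smul_apply', h2]

/-- The sampling scheme prescribes probabilities only for tuples of indices below `n`. These tuples
give disjoint events whose total probability is the expectation of (∑ π)^s = 1, so nothing is left
for other tuples. -/
theorem ae_draws_lt (hZ : ∀ i, Measurable (Z i)) (hπ : IsSubsamplingDistribution μ Z π)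
    (hI : IsSampledWithReplacement μ Z π s I) (hn : 1 ≤ n) : ∀ᵐ ω ∂μ, ∀ j, I n j ω < n := by
  set S := Fintype.piFinset (fun _ : Fin (s n) => Finset.range n) with hS
  have hSn : ∀ a ∈ S, ∀ j, a j < n := fun a ha j => by
    simpa using Fintype.mem_piFinset.1 ha j
  have key := fun a (ha : a ∈ S) => integral_indicator_draws_smul hZ hI (hSn a ha)
    (G := fun _ => 1) stronglyMeasurable_const (by simp)
  have h1 : ∑ a ∈ S, ∫ ω, {ω | ∀ j, I n j ω = a j}.indicator (fun _ => (1 : ℝ)) ω • (1 : ℂ) ∂μ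
      = 1 := by
    rw [Finset.sum_congr rfl fun a ha => (key a ha).2.2,
      ← integral_finsetSum _ fun a ha => (key a ha).1]
    rw [integral_congr_ae (g := fun _ => 1), integral_const]
    · simp
    filter_upwards [hπ.sum_eq_one n hn] with ω hω
    have := Finset.sum_prod_piFinset (Finset.range n) (fun (_ : Fin (s n)) i => π n i ω)
    rw [← Finset.sum_smul, hS, this]
    simp [hω]
  have h2 : ∑ a ∈ S, μ.real {ω | ∀ j, I n j ω = a j} = 1 := by
    have := congrArg Complex.re h1
    rw [Complex.re_sum, Complex.one_re] at this
    rw [← this]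
    refine Finset.sum_congr rfl fun a _ => ?_
    rw [integral_smul_const, integral_indicator_const _ (measurableSet_draws hI a)]
    simp
  have h3 : μ.real (⋃ a ∈ S, {ω | ∀ j, I n j ω = a j}) = 1 := by
    rw [measureReal_biUnion_finset _ fun a _ => measurableSet_draws hI a, h2]
    intro a _ b _ hab
    rw [Function.onFun, Set.disjoint_left]
    intro ω h1 h2
    exact hab (funext fun j => (h1 j).symm.trans (h2 j))
  have h4 : ∀ᵐ ω ∂μ, ω ∈ ⋃ a ∈ S, {ω | ∀ j, I n j ω = a j} := by
    refine (mem_ae_iff_prob_eq_one₀ ?_).2 ?_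
    rotate_left
    · rw [measureReal_def] at h3
      exact (ENNReal.toReal_eq_one_iff _).1 h3
    · exact (S.measurableSet_biUnion fun a _ => measurableSet_draws hI a).nullMeasurableSet
  filter_upwards [h4] with ω hω j
  simp only [Set.mem_iUnion] at hω
  obtain ⟨a, ha, hω⟩ := hω
  rw [hω j]
  exact hSn a ha j

/-- The characteristic function of a sum over the draws. -/
theorem integral_exp_sum_draws (hZ : ∀ i, Measurable (Z i)) (hπ : IsSubsamplingDistribution μ Z π)
    (hI : IsSampledWithReplacement μ Z π s I) (hn : 1 ≤ n) {Y : ℕ → Ω → ℝ}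
    (hY : ∀ i < n, Measurable[dataSigma Z n] (Y i)) :
    ∫ ω, Complex.exp ((∑ j, Y (I n j ω) ω : ℝ) * Complex.I) ∂μ
      = ∫ ω, (∑ i ∈ Finset.range n, (π n i ω : ℂ) * Complex.exp (Y i ω * Complex.I)) ^ (s n) ∂μ := by
  set S := Fintype.piFinset (fun _ : Fin (s n) => Finset.range n) with hS
  have hSn : ∀ a ∈ S, ∀ j, a j < n := fun a ha j => by
    simpa using Fintype.mem_piFinset.1 ha j
  have hGm : ∀ a ∈ S, StronglyMeasurable[dataSigma Z n]
      fun ω => Complex.exp ((∑ j, Y (a j) ω : ℝ) * Complex.I) := fun a ha => by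
    have h : Measurable[dataSigma Z n] fun ω => ∑ j, Y (a j) ω :=
      Finset.measurable_fun_sum _ fun j _ => hY _ (hSn a ha j)
    exact ((by fun_prop : Measurable fun x : ℝ => Complex.exp (x * Complex.I)).comp
      h).stronglyMeasurable
  have key := fun a (ha : a ∈ S) => integral_indicator_draws_smul hZ hI (hSn a ha) (hGm a ha)
    (fun ω => (Complex.norm_exp_ofReal_mul_I _).le)
  calc ∫ ω, Complex.exp ((∑ j, Y (I n j ω) ω : ℝ) * Complex.I) ∂μ
      = ∫ ω, ∑ a ∈ S, {ω | ∀ j, I n j ω = a j}.indicator (fun _ => (1 : ℝ)) ω •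
          Complex.exp ((∑ j, Y (a j) ω : ℝ) * Complex.I) ∂μ := by
        refine integral_congr_ae ?_
        filter_upwards [ae_draws_lt hZ hπ hI hn] with ω hω
        -- Only the realized tuple of indices has a nonzero indicator.
        rw [Finset.sum_eq_single (fun j => I n j ω)]
        · simp
        · intro b _ hb
          rw [Set.indicator_of_notMem, zero_smul]
          exact fun h => hb (funext fun j => (h j).symm)
        · exact fun h => absurd (Fintype.mem_piFinset.2 fun j => by simpa using hω j) h
    _ = ∫ ω, ∑ a ∈ S, (∏ j, π n (a j) ω) • Complex.exp ((∑ j, Y (a j) ω : ℝ) * Complex.I) ∂μ := by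
        rw [integral_finsetSum _ fun a ha => (key a ha).2.1,
          integral_finsetSum _ fun a ha => (key a ha).1]
        exact Finset.sum_congr rfl fun a ha => (key a ha).2.2
    _ = _ := by
        refine integral_congr_ae (ae_of_all _ fun ω => ?_)
        simp only
        have := Finset.sum_prod_piFinset (Finset.range n)
          (fun (_ : Fin (s n)) i => (π n i ω : ℂ) * Complex.exp (Y i ω * Complex.I))
        rw [Finset.prod_const, Finset.card_univ, Fintype.card_fin] at this
        rw [← this]
        refine Finset.sum_congr rfl fun a _ => ?_
        rw [Finset.prod_mul_distrib, ← Complex.exp_sum, Complex.real_smul]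
        push_cast
        rw [Finset.sum_mul]

omit [IsProbabilityMeasure μ] in
theorem ae_forall_pos (hπ : IsSubsamplingDistribution μ Z π) :
    ∀ᵐ ω ∂μ, ∀ n, ∀ i < n, 0 < π n i ω := by
  rw [ae_all_iff]; intro n
  rw [ae_all_iff]; intro i
  rw [eventually_imp_distrib_left]
  exact hπ.pos n i

/-- Sum over the draws of `F i`, where draws outside `{0, …, n - 1}` are ignored. -/
noncomputable def drawSum {E : Type*} [AddCommMonoid E] (I : (n : ℕ) → Fin (s n) → Ω → ℕ) (n : ℕ)
    (F : ℕ → Ω → E) (ω : Ω) : E :=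
  ∑ j, ∑ i ∈ Finset.range n, if I n j ω = i then F i ω else 0

omit [MeasurableSpace Ω] in
theorem drawSum_eq {E : Type*} [AddCommMonoid E] {F : ℕ → Ω → E} {ω : Ω}
    (h : ∀ j, I n j ω < n) : drawSum I n F ω = ∑ j, F (I n j ω) ω := by
  refine Finset.sum_congr rfl fun j _ => ?_
  rw [Finset.sum_ite_eq, if_pos (by simpa using h j)]

omit [IsProbabilityMeasure μ] in
-- Since out-of-range draws are ignored, this is a finite sum of indicators times `F i` with `i <
-- n`. Nothing is known about the measurability of `π n i` for `i ≥ n`.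
theorem aemeasurable_drawSum {E : Type*} [NormedAddCommGroup E] [MeasurableSpace E] [BorelSpace E]
    [SecondCountableTopology E] (hI : IsSampledWithReplacement μ Z π s I)
    {F : ℕ → Ω → E} (hF : ∀ i < n, AEMeasurable (F i) μ) : AEMeasurable (drawSum I n F) μ := by
  unfold drawSum
  refine Finset.aemeasurable_fun_sum _ fun j _ => Finset.aemeasurable_fun_sum _ fun i hi => ?_
  refine ((hF i (by simpa using hi)).indicator
    (hI.measurable n j (measurableSet_singleton i))).congr (ae_of_all _ fun ω => ?_)
  by_cases h : I n j ω = i <;> simp [h]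

end Draws

/-! ### Replacing the conditional characteristic function by an exponential. -/

section DrawLimit

variable {Ω 𝒵 : Type*} [MeasurableSpace Ω] [MeasurableSpace 𝒵] {μ : Measure Ω}
  [IsProbabilityMeasure μ] {Z : ℕ → Ω → 𝒵} {π : ℕ → ℕ → Ω → ℝ} {s : ℕ → ℕ}
  {I : (n : ℕ) → Fin (s n) → Ω → ℕ}

/-- Conditional characteristic function of one draw of `Y`. -/
noncomputable def drawCharFun (π : ℕ → ℕ → Ω → ℝ) (Y : ℕ → ℕ → Ω → ℝ) (n : ℕ) (ω : Ω) : ℂ :=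
  ∑ i ∈ Finset.range n, (π n i ω : ℂ) * Complex.exp (Y n i ω * Complex.I)

omit [IsProbabilityMeasure μ] in
theorem ae_norm_drawCharFun_le (hπ : IsSubsamplingDistribution μ Z π) {Y : ℕ → ℕ → Ω → ℝ} (n : ℕ) :
    ∀ᵐ ω ∂μ, ‖drawCharFun π Y n ω‖ ≤ 1 := by
  rcases Nat.eq_zero_or_pos n with rfl | hn
  · simp [drawCharFun]
  filter_upwards [ae_forall_pos hπ, hπ.sum_eq_one n hn] with ω h1 h2
  refine (norm_sum_le _ _).trans ?_
  rw [← h2]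
  refine Finset.sum_le_sum fun i hi => ?_
  rw [norm_mul, Complex.norm_exp_ofReal_mul_I, mul_one, Complex.norm_real, Real.norm_eq_abs,
    abs_of_pos (h1 n i (by simpa using hi))]

omit [IsProbabilityMeasure μ] in
theorem aestronglyMeasurable_drawCharFun (hZ : ∀ i, Measurable (Z i))
    (hπ : IsSubsamplingDistribution μ Z π) {Y : ℕ → ℕ → Ω → ℝ}
    (hY : ∀ n, ∀ i < n, Measurable[dataSigma Z n] (Y n i)) (n : ℕ) :
    AEStronglyMeasurable (drawCharFun π Y n) μ := by
  refine Measurable.aestronglyMeasurable ?_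
  refine Finset.measurable_fun_sum _ fun i hi => ?_
  have h1 := (hY n i (by simpa using hi)).mono (dataSigma_le hZ n) le_rfl
  have h2 := (hπ.measurable n i (by simpa using hi)).mono (dataSigma_le hZ n) le_rfl
  fun_prop

/-- The exponent `c n` may stay random in the limit. It need only match `s (φ - 1)` up to o_P(1) and
be o_P(√s). Both exponentials are bounded, so convergence in probability passes to expectations. -/
theorem tendsto_integral_exp_draws_sub (hZ : ∀ i, Measurable (Z i))
    (hπ : IsSubsamplingDistribution μ Z π) (hI : IsSampledWithReplacement μ Z π s I)
    (hs : Tendsto s atTop atTop) {Y : ℕ → ℕ → Ω → ℝ}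
    (hY : ∀ n, ∀ i < n, Measurable[dataSigma Z n] (Y n i))
    {c : ℕ → Ω → ℂ} (hcm : ∀ n, AEStronglyMeasurable (c n) μ) (hc : ∀ n ω, (c n ω).re ≤ 0)
    (h1 : TendstoInMeasure μ (fun n ω => s n * (drawCharFun π Y n ω - 1) - c n ω) atTop
      (fun _ => 0))
    (h2 : TendstoInMeasure μ (fun n ω => (√(s n))⁻¹ • c n ω) atTop (fun _ => 0)) :
    Tendsto (fun n => ∫ ω, Complex.exp ((∑ j, Y n (I n j ω) ω : ℝ) * Complex.I) ∂μ
      - ∫ ω, Complex.exp (c n ω) ∂μ) atTop (𝓝 0) := by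
  have hφm := aestronglyMeasurable_drawCharFun hZ hπ hY
  have hφ := fun n => ae_norm_drawCharFun_le hπ (Y := Y) n
  have hsq : Tendsto (fun n => √(s n : ℝ)) atTop atTop :=
    Real.tendsto_sqrt_atTop.comp (tendsto_natCast_atTop_atTop.comp hs)
  -- Dividing (s(φ - 1) - c) + c by √s gives √s(φ - 1). The square of its norm is s‖φ - 1‖², the
  -- first error term of `norm_pow_sub_exp_le`.
  have h3 : TendstoInMeasure μ (fun n ω => √(s n) • (drawCharFun π Y n ω - 1)) atTop
      (fun _ => 0) := by
    refine ((h1.zero_tendsto_smul hsq.inv_tendsto_atTop).zero_add h2).congr' ?_ EventuallyEq.rfl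
    filter_upwards [hs.eventually_ge_atTop 1] with n hn
    refine ae_of_all _ fun ω => ?_
    have hp : (0 : ℝ) < √(s n) := Real.sqrt_pos.2 (by exact_mod_cast hn)
    simp only [Pi.inv_apply]
    rw [smul_sub, sub_add_cancel, ← Complex.ofReal_natCast, ← Complex.real_smul, smul_smul]
    congr 1
    field_simp
    rw [Real.sq_sqrt (by positivity)]
  have hbd : ∀ n, ∀ᵐ ω ∂μ, ‖drawCharFun π Y n ω ^ s n - Complex.exp (c n ω)‖ ≤ 2 := fun n => by
    filter_upwards [hφ n] with ω hω
    refine (norm_sub_le _ _).trans ?_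
    rw [norm_pow, Complex.norm_exp]
    linarith [pow_le_one₀ (norm_nonneg _) hω (n := s n), Real.exp_le_one_iff.2 (hc n ω)]
  have h4 : TendstoInMeasure μ
      (fun n ω => drawCharFun π Y n ω ^ s n - Complex.exp (c n ω)) atTop (fun _ => 0) := by
    have hsqr : TendstoInMeasure μ (fun n ω => ‖√(s n) • (drawCharFun π Y n ω - 1)‖ ^ 2) atTop
        (fun _ => 0) := by
      rw [tendstoInMeasure_zero_iff] at h3 ⊢
      intro ε hε
      convert h3 (√ε) (by positivity) using 5
      rw [Real.norm_eq_abs, abs_of_nonneg (by positivity), Real.sqrt_le_left (norm_nonneg _)]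
    refine ((hsqr.zero_const_smul 2).zero_add h1.zero_norm).zero_of_le ?_
    refine Eventually.of_forall fun n => ?_
    filter_upwards [hφ n] with ω hω
    refine (norm_pow_sub_exp_le hω (hc n ω) (s n)).trans ?_
    refine le_trans (le_of_eq ?_) (le_abs_self _)
    rw [norm_smul, mul_pow, Real.norm_eq_abs, sq_abs, Real.sq_sqrt (by positivity)]
    simp
  have hexp : ∀ n, Integrable (fun ω => Complex.exp (c n ω)) μ := fun n => by
    refine Integrable.of_bound (Complex.continuous_exp.comp_aestronglyMeasurable (hcm n)) 1
      (ae_of_all _ fun ω => ?_)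
    rw [Complex.norm_exp]
    exact Real.exp_le_one_iff.2 (hc n ω)
  have hpow : ∀ n, Integrable (fun ω => drawCharFun π Y n ω ^ s n) μ := fun n => by
    refine Integrable.of_bound ((hφm n).pow _) 1 ?_
    filter_upwards [hφ n] with ω hω
    rw [norm_pow]
    exact pow_le_one₀ (norm_nonneg _) hω
  have h5 := h4.tendsto_integral_zero hbd fun n => (hpow n).1.sub (hexp n).1
  refine h5.congr' ?_
  filter_upwards [eventually_ge_atTop 1] with n hn
  rw [integral_exp_sum_draws hZ hπ hI hn (hY n), integral_sub (hpow n) (hexp n)]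
  rfl

end DrawLimit

/-! ### Limit theorems for averages over the full data. -/

section FullData

variable {Ω 𝒵 : Type*} [MeasurableSpace Ω] [MeasurableSpace 𝒵] {μ : Measure Ω}
  [IsProbabilityMeasure μ] {P : Measure 𝒵} [IsProbabilityMeasure P] {Z : ℕ → Ω → 𝒵}

/-- The average of `f` over the full data. -/
noncomputable def fullMean (Z : ℕ → Ω → 𝒵) (f : 𝒵 → ℝ) (n : ℕ) (ω : Ω) : ℝ :=
  (n : ℝ)⁻¹ * ∑ i ∈ Finset.range n, f (Z i ω)

omit [IsProbabilityMeasure μ] [IsProbabilityMeasure P] in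
theorem measurable_fullMean (hZ : ∀ i, Measurable (Z i)) {f : 𝒵 → ℝ} (hf : Measurable f) (n : ℕ) :
    Measurable (fullMean Z f n) :=
  (Finset.measurable_fun_sum _ fun i _ => hf.comp (hZ i)).const_mul _

omit [IsProbabilityMeasure μ] [IsProbabilityMeasure P] in
theorem identDistrib_comp (hZ : ∀ i, Measurable (Z i)) (hlaw : ∀ i, μ.map (Z i) = P) {f : 𝒵 → ℝ}
    (hf : Measurable f) (i : ℕ) :
    IdentDistrib (fun ω => f (Z i ω)) (fun ω => f (Z 0 ω)) μ μ :=
  IdentDistrib.comp ⟨(hZ i).aemeasurable, (hZ 0).aemeasurable, by rw [hlaw, hlaw]⟩ hf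

omit [IsProbabilityMeasure μ] [IsProbabilityMeasure P] in
theorem integral_comp_data (hZ : ∀ i, Measurable (Z i)) (hlaw : ∀ i, μ.map (Z i) = P) {f : 𝒵 → ℝ}
    (hf : Measurable f) (i : ℕ) : ∫ ω, f (Z i ω) ∂μ = ∫ z, f z ∂P := by
  rw [← hlaw i, integral_map (hZ i).aemeasurable hf.aestronglyMeasurable]

omit [IsProbabilityMeasure P] in
theorem tendstoInMeasure_fullMean (hZ : ∀ i, Measurable (Z i)) (hlaw : ∀ i, μ.map (Z i) = P)
    (hind : iIndepFun Z μ) {f : 𝒵 → ℝ} (hf : Measurable f) (hfi : Integrable f P) :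
    TendstoInMeasure μ (fullMean Z f) atTop (fun _ => ∫ z, f z ∂P) := by
  refine tendstoInMeasure_of_tendsto_ae
    (fun n => (measurable_fullMean hZ hf n).aestronglyMeasurable) ?_
  have h := strong_law_ae (μ := μ) (fun i ω => f (Z i ω))
    (by
      rw [← hlaw 0] at hfi
      exact hfi.comp_measurable (hZ 0))
    (fun i j hij => (hind.indepFun hij).comp hf hf) (identDistrib_comp hZ hlaw hf)
  rw [integral_comp_data hZ hlaw hf 0] at h
  exact h

omit [IsProbabilityMeasure P] in
-- The integrand varies with `n`, so the strong law does not apply. Instead E|mean| ≤ E|h n|, and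
-- Markov's inequality finishes. This disposes of the Lindeberg remainder.
theorem tendstoInMeasure_fullMean_zero (hZ : ∀ i, Measurable (Z i)) (hlaw : ∀ i, μ.map (Z i) = P)
    {h : ℕ → 𝒵 → ℝ} (hm : ∀ n, Measurable (h n))
    (hlim : Tendsto (fun n => ∫⁻ z, ENNReal.ofReal ‖h n z‖ ∂P) atTop (𝓝 0)) :
    TendstoInMeasure μ (fun n => fullMean Z (h n) n) atTop (fun _ => 0) := by
  refine tendstoInMeasure_zero_of_lintegral
    (fun n => (measurable_fullMean hZ (hm n) n).aemeasurable) ?_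
  refine tendsto_of_tendsto_of_tendsto_of_le_of_le tendsto_const_nhds hlim
    (fun _ => zero_le) fun n => ?_
  have hi : ∀ i, ∫⁻ ω, ENNReal.ofReal ‖h n (Z i ω)‖ ∂μ = ∫⁻ z, ENNReal.ofReal ‖h n z‖ ∂P := by
    intro i
    have := hm n
    rw [← hlaw i, lintegral_map (by fun_prop) (hZ i)]
  have hle : ∀ ω, ENNReal.ofReal ‖fullMean Z (h n) n ω‖
      ≤ ENNReal.ofReal (n : ℝ)⁻¹ * ∑ i ∈ Finset.range n, ENNReal.ofReal ‖h n (Z i ω)‖ := by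
    intro ω
    rw [← ENNReal.ofReal_sum_of_nonneg (fun _ _ => norm_nonneg _),
      ← ENNReal.ofReal_mul (by positivity)]
    refine ENNReal.ofReal_le_ofReal ?_
    rw [fullMean, norm_mul, Real.norm_of_nonneg (by positivity)]
    gcongr
    exact norm_sum_le _ _
  refine (lintegral_mono hle).trans ?_
  have hmeas : ∀ i, Measurable fun ω => ENNReal.ofReal ‖h n (Z i ω)‖ := fun i => by
    have := (hm n).comp (hZ i)
    exact this.norm.ennreal_ofReal
  rw [lintegral_const_mul _ (Finset.measurable_fun_sum _ fun i _ => hmeas i),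
    lintegral_finsetSum _ fun i _ => hmeas i, Finset.sum_congr rfl fun i _ => hi i]
  rw [Finset.sum_const, Finset.card_range, nsmul_eq_mul, ← mul_assoc]
  refine mul_le_of_le_one_left zero_le ?_
  rcases Nat.eq_zero_or_pos n with rfl | hn
  · simp
  · rw [← ENNReal.ofReal_natCast, ← ENNReal.ofReal_mul (by positivity),
      inv_mul_cancel₀ (by positivity)]
    simp

omit [IsProbabilityMeasure P] in
-- Write √s as √(s/n) · √n. The central limit theorem handles √n times the mean, and Slutsky's
-- theorem handles the deterministic factor tending to √c.
theorem tendsto_integral_exp_sqrt_mul_fullMean (hZ : ∀ i, Measurable (Z i))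
    (hlaw : ∀ i, μ.map (Z i) = P) (hind : iIndepFun Z μ) {s : ℕ → ℕ} {c : ℝ}
    (hc : Tendsto (fun n => (s n : ℝ) / (n : ℝ)) atTop (𝓝 c))
    {f : 𝒵 → ℝ} (hf : Measurable f) (hf2 : MemLp f 2 P) (hf0 : ∫ z, f z ∂P = 0) :
    Tendsto (fun n => ∫ ω, Complex.exp ((√(s n) * fullMean Z f n ω : ℝ) * Complex.I) ∂μ) atTop
      (𝓝 (Complex.exp (-(c * ∫ z, f z ^ 2 ∂P : ℝ) / 2))) := by
  have hc0 : 0 ≤ c := ge_of_tendsto' hc fun n => by positivity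
  set X : ℕ → Ω → ℝ := fun i ω => f (Z i ω) with hXdef
  have hX : MemLp (X 0) 2 μ := by
    rw [← hlaw 0] at hf2
    exact hf2.comp_measurePreserving ⟨hZ 0, rfl⟩
  have h0 : μ[X 0] = 0 := (integral_comp_data hZ hlaw hf 0).trans hf0
  have hv : Var[X 0; μ] = ∫ z, f z ^ 2 ∂P := by
    rw [variance_of_integral_eq_zero hX.1.aemeasurable h0]
    exact integral_comp_data hZ hlaw (f := fun z => f z ^ 2) (by fun_prop) 0
  have hXi : iIndepFun X μ := hind.comp (fun _ => f) fun _ => hf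
  have hclt := tendstoInDistribution_inv_sqrt_mul_sum_sub
    (HasLaw.id (μ := gaussianReal 0 Var[X 0; μ].toNNReal)) hX hXi (identDistrib_comp hZ hlaw hf)
  rw [h0] at hclt
  have hsq : Tendsto (fun n => √((s n : ℝ) / n)) atTop (𝓝 √c) :=
    (Real.continuous_sqrt.tendsto c).comp hc
  have hsl := hclt.continuous_comp_prodMk_of_tendstoInMeasure_const
    (g := fun p : ℝ × ℝ => p.2 * p.1) (by fun_prop)
    (Y := fun n _ => √((s n : ℝ) / n)) (c := √c)
    (tendstoInMeasure_sub_const_iff.1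
      (tendstoInMeasure_zero_of_tendsto (by simpa using hsq.sub_const (√c))))
    (fun n => aemeasurable_const)
  have h1 := ProbabilityMeasure.tendsto_iff_tendsto_charFun.1 hsl.tendsto 1
  simp only [ProbabilityMeasure.coe_mk] at h1
  have hlim : charFun (Measure.map (fun x : ℝ => √c * id x)
      (gaussianReal 0 Var[X 0; μ].toNNReal)) 1
      = Complex.exp (-(c * ∫ z, f z ^ 2 ∂P : ℝ) / 2) := by
    have hm := gaussianReal_map_const_mul (μ := 0) (v := Var[X 0; μ].toNNReal) √c
    simp only [id]
    rw [hm, charFun_gaussianReal, hv]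
    congr 1
    push_cast
    rw [Real.coe_toNNReal _ (integral_nonneg fun z => sq_nonneg _), ← Complex.ofReal_pow,
      Real.sq_sqrt hc0]
    push_cast
    ring
  rw [hlim] at h1
  refine h1.congr fun n => ?_
  rw [charFun_apply, integral_map (hsl.forall_aemeasurable n) (by fun_prop)]
  refine integral_congr_ae (ae_of_all _ fun ω => ?_)
  simp only [hXdef, mul_zero, sub_zero, fullMean, RCLike.inner_apply,
    conj_trivial, one_mul]
  congr 3
  rw [Real.sqrt_div (by positivity)]
  rcases Nat.eq_zero_or_pos n with rfl | hn
  · simp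
  · have : (0 : ℝ) < n := by exact_mod_cast hn
    have h3 := Real.sqrt_pos.2 this
    field_simp
    rw [Real.sq_sqrt this.le]
    ring

end FullData

/-! ### Weak law and central limit theorem for weighted subsample means. -/

section Subsample

variable {Ω 𝒵 : Type*} [MeasurableSpace Ω] [MeasurableSpace 𝒵] {μ : Measure Ω}
  [IsProbabilityMeasure μ] {P : Measure 𝒵} {Z : ℕ → Ω → 𝒵}
  {π : ℕ → ℕ → Ω → ℝ} {s : ℕ → ℕ} {I : (n : ℕ) → Fin (s n) → Ω → ℕ}

omit [MeasurableSpace Ω] in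
theorem inv_le_iSup_inv {n i : ℕ} (hi : i < n) {K : ℝ} {ω : Ω}
    (h : |⨆ i : Fin n, ((n : ℝ) * π n i ω)⁻¹| ≤ K) : ((n : ℝ) * π n i ω)⁻¹ ≤ K :=
  (le_ciSup (f := fun i : Fin n => ((n : ℝ) * π n i ω)⁻¹) (Set.finite_range _).bddAbove
    ⟨i, hi⟩).trans ((le_abs_self _).trans h)

omit [MeasurableSpace Ω] in
theorem drawCharFun_sub_one {Y : ℕ → ℕ → Ω → ℝ} {n : ℕ} {ω : Ω}
    (h : ∑ i ∈ Finset.range n, π n i ω = 1) :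
    drawCharFun π Y n ω - 1
      = ∑ i ∈ Finset.range n, (π n i ω : ℂ) * (Complex.exp (Y n i ω * Complex.I) - 1) := by
  simp only [drawCharFun, mul_sub, mul_one, Finset.sum_sub_distrib]
  congr 1
  exact_mod_cast h.symm

/-- Inverse-probability-weighted mean of `f` over the subsample. -/
noncomputable def subMean {E : Type*} [AddCommMonoid E] [Module ℝ E] (Z : ℕ → Ω → 𝒵)
    (π : ℕ → ℕ → Ω → ℝ) (I : (n : ℕ) → Fin (s n) → Ω → ℕ) (f : 𝒵 → E) (n : ℕ) (ω : Ω) : E :=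
  ∑ j, ((n : ℝ) * s n * π n (I n j ω) ω)⁻¹ • f (Z (I n j ω) ω)

omit [IsProbabilityMeasure μ] in
theorem ae_forall_data (hZ : ∀ i, Measurable (Z i)) (hlaw : ∀ i, μ.map (Z i) = P) {p : 𝒵 → Prop}
    (h : ∀ᵐ z ∂P, p z) : ∀ᵐ ω ∂μ, ∀ i, p (Z i ω) := by
  rw [ae_all_iff]
  intro i
  refine ae_of_ae_map (hZ i).aemeasurable ?_
  rwa [hlaw i]

omit [IsProbabilityMeasure μ] in
theorem ae_subMean_congr {E : Type*} [AddCommMonoid E] [Module ℝ E] (hZ : ∀ i, Measurable (Z i))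
    (hlaw : ∀ i, μ.map (Z i) = P) {f g : 𝒵 → E} (h : f =ᵐ[P] g) :
    ∀ᵐ ω ∂μ, ∀ n, subMean Z π I f n ω = subMean Z π I g n ω := by
  filter_upwards [ae_forall_data hZ hlaw h] with ω hω n
  simp only [subMean, hω]

/-- The draws average to the full-data mean given the data, and the full-data mean obeys the law of
large numbers. Genuine measurability of `f` makes the summands measurable for the data σ-algebra, as
conditioning requires. -/
theorem tendstoInMeasure_subMean_of_measurable (hZ : ∀ i, Measurable (Z i))
    (hlaw : ∀ i, μ.map (Z i) = P) (hind : iIndepFun Z μ) [IsProbabilityMeasure P]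
    (hπ : IsSubsamplingDistribution μ Z π) (hI : IsSampledWithReplacement μ Z π s I)
    (hs : Tendsto s atTop atTop)
    (hW : BoundedInProb μ fun n ω => ⨆ i : Fin n, ((n : ℝ) * π n i ω)⁻¹)
    {f : 𝒵 → ℝ} (hf : Measurable f) (hf2 : MemLp f 2 P) :
    TendstoInMeasure μ (subMean Z π I f) atTop (fun _ => ∫ z, f z ∂P) := by
  have hsR : Tendsto (fun n => (s n : ℝ)) atTop atTop := tendsto_natCast_atTop_atTop.comp hs
  have hmean := tendstoInMeasure_fullMean hZ hlaw hind hf (hf2.integrable (by norm_num))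
  have hsqmean := tendstoInMeasure_fullMean hZ hlaw hind (f := fun z => f z ^ 2) (by fun_prop)
    hf2.integrable_sq
  set F : ℕ → ℕ → Ω → ℝ := fun n i ω => ((n : ℝ) * s n * π n i ω)⁻¹ • f (Z i ω) with hF
  have hFm : ∀ n, ∀ i < n, Measurable[dataSigma Z n] (F n i) := fun n i hi => by
    have h1 := hπ.measurable n i hi
    have h2 := hf.comp (measurable_dataSigma (Z := Z) hi)
    exact Measurable.mul (Measurable.inv (Measurable.const_mul h1 _)) h2
  have hdraw : TendstoInMeasure μ (fun n => drawSum I n (F n)) atTop (fun _ => ∫ z, f z ∂P) := by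
    -- Convergence in law to a constant suffices, so the proof can go through characteristic
    -- functions with a Dirac limit.
    refine tendstoInMeasure_of_tendstoInDistribution_const
      (μ' := Measure.dirac (∫ z, f z ∂P)) ?_
    have hVm : ∀ n, AEMeasurable (drawSum I n (F n)) μ := fun n => aemeasurable_drawSum hI
      fun i hi => ((hFm n i hi).mono (dataSigma_le hZ n) le_rfl).aemeasurable
    refine TendstoInDistribution.congr (Z := id) (fun n => EventuallyEq.rfl) ?_
      (tendstoInDistribution_of_charFun hVm fun u => ?_)
    · exact (ae_dirac_iff (measurableSet_eq_fun measurable_id measurable_const)).2 rfl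
    rw [charFun_dirac]
    have hlim := tendsto_integral_exp_draws_sub hZ hπ hI hs (Y := fun n i ω => u * F n i ω)
      (fun n i hi => (hFm n i hi).const_mul u) (c := fun n ω => (u * fullMean Z f n ω : ℝ) * Complex.I)
      (fun n => by
        have := measurable_fullMean hZ hf n
        exact Measurable.aestronglyMeasurable (by fun_prop)) (fun n ω => by simp) ?_ ?_
    · have hexp : Tendsto
          (fun n => ∫ ω, Complex.exp ((u * fullMean Z f n ω : ℝ) * Complex.I) ∂μ) atTop
          (𝓝 (Complex.exp ((inner ℝ (∫ z, f z ∂P) u : ℝ) * Complex.I))) := by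
        have hd := hmean.tendstoInDistribution_of_aemeasurable
          (fun n => (measurable_fullMean hZ hf n).aemeasurable) aemeasurable_const
        have := ProbabilityMeasure.tendsto_iff_tendsto_charFun.1 hd.tendsto u
        simp only [ProbabilityMeasure.coe_mk, Measure.map_const, measure_univ, one_smul,
          charFun_dirac] at this
        refine this.congr fun n => ?_
        rw [charFun_apply, integral_map (hd.forall_aemeasurable n) (by fun_prop)]
        simp
      have := hlim.add hexp
      rw [zero_add] at this
      refine this.congr' ?_
      filter_upwards [eventually_ge_atTop 1] with n hn
      rw [sub_add_cancel]
      refine integral_congr_ae ?_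
      filter_upwards [ae_draws_lt hZ hπ hI hn] with ω hω
      rw [drawSum_eq hω]
      simp [Finset.mul_sum]
    -- When every (nπ)⁻¹ is at most K, the first-order Taylor remainder is at most 3u²K/s times the
    -- full-data mean of f².
    · refine TendstoInMeasure.zero_of_boundedInProb hW fun K hK =>
        ⟨fun n ω => (3 * u ^ 2 * K * (s n : ℝ)⁻¹) • fullMean Z (fun z => f z ^ 2) n ω, ?_, ?_⟩
      · refine TendstoInMeasure.zero_smul_of_const ?_ hsqmean
        simpa using (hsR.inv_tendsto_atTop).const_mul (3 * u ^ 2 * K)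
      · filter_upwards [eventually_ge_atTop 1, hs.eventually_ge_atTop 1] with n hn hsn
        have hn0 : (0 : ℝ) < n := by exact_mod_cast hn
        have hs0 : (0 : ℝ) < s n := by exact_mod_cast hsn
        filter_upwards [ae_forall_pos hπ, hπ.sum_eq_one n hn] with ω hpos hsum hK'
        have hexpand : (s n : ℂ) * (drawCharFun π (fun n i ω => u * F n i ω) n ω - 1)
            - (u * fullMean Z f n ω : ℝ) * Complex.I
            = ∑ i ∈ Finset.range n, ((s n * π n i ω : ℝ) : ℂ) *
              (Complex.exp ((u * F n i ω : ℝ) * Complex.I) - 1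
                - (u * F n i ω : ℝ) * Complex.I) := by
          rw [drawCharFun_sub_one hsum, fullMean, Finset.mul_sum]
          simp only [Finset.mul_sum, Complex.ofReal_sum, Finset.sum_mul]
          rw [← Finset.sum_sub_distrib]
          refine Finset.sum_congr rfl fun i hi => ?_
          have hp : (π n i ω : ℂ) ≠ 0 := by
            exact_mod_cast (hpos n i (by simpa using hi)).ne'
          have hn' : (n : ℂ) ≠ 0 := by exact_mod_cast hn0.ne'
          have hs' : (s n : ℂ) ≠ 0 := by exact_mod_cast hs0.ne'
          simp only [hF, smul_eq_mul]
          push_cast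
          field_simp
        rw [hexpand]
        refine (norm_sum_le _ _).trans ((Finset.sum_le_sum (g := fun i =>
          (3 * u ^ 2 * K * (s n : ℝ)⁻¹ * (n : ℝ)⁻¹) * f (Z i ω) ^ 2) fun i hi => ?_).trans ?_)
        · have hp := hpos n i (by simpa using hi)
          have hKi := inv_le_iSup_inv (by simpa using hi) hK'
          rw [norm_mul, Complex.norm_real, Real.norm_of_nonneg (by positivity)]
          calc s n * π n i ω * _ ≤ s n * π n i ω * (3 * (u * F n i ω) ^ 2) := by
                gcongr
                exact norm_exp_mul_I_sub_taylor_one_le _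
            _ = (3 * u ^ 2 * (s n : ℝ)⁻¹ * (n : ℝ)⁻¹ * f (Z i ω) ^ 2) * ((n : ℝ) * π n i ω)⁻¹ := by
                simp only [hF, smul_eq_mul]
                field_simp
            _ ≤ (3 * u ^ 2 * (s n : ℝ)⁻¹ * (n : ℝ)⁻¹ * f (Z i ω) ^ 2) * K := by gcongr
            _ = _ := by ring
        · refine le_trans (le_of_eq ?_) (le_abs_self _)
          rw [← Finset.mul_sum, fullMean, smul_eq_mul]
          ring
    · refine ((hmean.zero_smul_of_const (a := fun n => (√(s n))⁻¹) ?_).zero_const_smul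
        |u|).zero_of_le (Eventually.of_forall fun n => ae_of_all _ fun ω => le_of_eq ?_)
      · exact (Real.tendsto_sqrt_atTop.comp hsR).inv_tendsto_atTop
      · simp only [norm_smul, norm_mul, Complex.norm_real, Complex.norm_I, Real.norm_eq_abs, abs_abs]
        ring
  refine hdraw.congr' ?_ EventuallyEq.rfl
  filter_upwards [eventually_ge_atTop 1] with n hn
  filter_upwards [ae_draws_lt hZ hπ hI hn] with ω hω
  rw [drawSum_eq hω]
  rfl

/-- Weak law of large numbers for the weighted subsample mean. -/
theorem tendstoInMeasure_subMean (hZ : ∀ i, Measurable (Z i))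
    (hlaw : ∀ i, μ.map (Z i) = P) (hind : iIndepFun Z μ) [IsProbabilityMeasure P]
    (hπ : IsSubsamplingDistribution μ Z π) (hI : IsSampledWithReplacement μ Z π s I)
    (hs : Tendsto s atTop atTop)
    (hW : BoundedInProb μ fun n ω => ⨆ i : Fin n, ((n : ℝ) * π n i ω)⁻¹)
    {f : 𝒵 → ℝ} (hf2 : MemLp f 2 P) :
    TendstoInMeasure μ (subMean Z π I f) atTop (fun _ => ∫ z, f z ∂P) := by
  -- Changing `f` on a `P`-null set almost surely affects no observation, so a measurable
  -- representative may be used.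
  have hmk := hf2.1.ae_eq_mk
  rw [integral_congr_ae hmk]
  refine (tendstoInMeasure_subMean_of_measurable hZ hlaw hind hπ hI hs hW
    hf2.1.stronglyMeasurable_mk.measurable (hf2.ae_eq hmk)).congr_left fun n => ?_
  filter_upwards [ae_subMean_congr (I := I) (π := π) hZ hlaw hmk] with ω hω using (hω n).symm

set_option maxHeartbeats 800000 in
-- The resampling noise contributes the deterministic factor exp(-v/2) and the full-data mean
-- supplies a Gaussian factor of variance c E f². The product of the two is the limit.
theorem tendsto_integral_exp_subMean_of_measurable (hZ : ∀ i, Measurable (Z i))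
    (hlaw : ∀ i, μ.map (Z i) = P) (hind : iIndepFun Z μ) [IsProbabilityMeasure P]
    (hπ : IsSubsamplingDistribution μ Z π) (hI : IsSampledWithReplacement μ Z π s I)
    (hs : Tendsto s atTop atTop) {c : ℝ}
    (hc : Tendsto (fun n => (s n : ℝ) / (n : ℝ)) atTop (𝓝 c))
    (hW : BoundedInProb μ fun n ω => ⨆ i : Fin n, ((n : ℝ) * π n i ω)⁻¹)
    {f : 𝒵 → ℝ} (hf : Measurable f) (hf2 : MemLp f 2 P) (hf0 : ∫ z, f z ∂P = 0) {v : ℝ}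
    (hv0 : 0 ≤ v)
    (hv : TendstoInMeasure μ
      (fun (n : ℕ) ω => ((n : ℝ) ^ 2)⁻¹ * ∑ i ∈ Finset.range n, f (Z i ω) ^ 2 / π n i ω) atTop
      (fun _ => v)) :
    Tendsto (fun n => ∫ ω, Complex.exp ((√(s n) * subMean Z π I f n ω : ℝ) * Complex.I) ∂μ) atTop
      (𝓝 (Complex.exp (-(v + c * ∫ z, f z ^ 2 ∂P : ℝ) / 2))) := by
  have hsR : Tendsto (fun n => (s n : ℝ)) atTop atTop := tendsto_natCast_atTop_atTop.comp hs
  have hsq : Tendsto (fun n => (√(s n : ℝ))⁻¹) atTop (𝓝 0) :=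
    (Real.tendsto_sqrt_atTop.comp hsR).inv_tendsto_atTop
  have hmean := tendstoInMeasure_fullMean hZ hlaw hind hf (hf2.integrable (by norm_num))
  rw [hf0] at hmean
  set Y : ℕ → ℕ → Ω → ℝ := fun n i ω => √(s n) * (((n : ℝ) * s n * π n i ω)⁻¹ • f (Z i ω)) with hY
  have hYm : ∀ n, ∀ i < n, Measurable[dataSigma Z n] (Y n i) := fun n i hi => by
    have h1 := hπ.measurable n i hi
    have h2 := hf.comp (measurable_dataSigma (Z := Z) hi)
    exact Measurable.const_mul (Measurable.mul (Measurable.inv (Measurable.const_mul h1 _)) h2) _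
  -- The second-order expansion of s(φ - 1), with the weighted empirical second moment replaced by
  -- its limit `v`.
  set g : ℕ → Ω → ℂ := fun n ω =>
    (√(s n) * fullMean Z f n ω : ℝ) * Complex.I - (v / 2 : ℝ) with hg
  have hlim := tendsto_integral_exp_draws_sub hZ hπ hI hs hYm (c := g)
      (fun n => by
        have := measurable_fullMean hZ hf n
        exact Measurable.aestronglyMeasurable (by fun_prop))
      (fun n ω => by simp only [hg]; simp; linarith) ?_ ?_
  · have hexp := (tendsto_integral_exp_sqrt_mul_fullMean hZ hlaw hind hc hf hf2 hf0).mul_const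
      (Complex.exp (-(v / 2 : ℝ)))
    have := hlim.add hexp
    rw [zero_add, ← Complex.exp_add] at this
    convert this using 1
    · ext n
      rw [← integral_mul_const]
      have : ∀ ω, Complex.exp ((√(s n) * fullMean Z f n ω : ℝ) * Complex.I)
          * Complex.exp (-(v / 2 : ℝ)) = Complex.exp (g n ω) := fun ω => by
        rw [← Complex.exp_add, ← sub_eq_add_neg]
      simp only [this]
      rw [sub_add_cancel]
      simp only [subMean, hY, Finset.mul_sum]
    · congr 2
      push_cast
      ring
  -- The added term turns `v` back into the empirical second moment, so that only the Taylor
  -- remainder is left. The error of that replacement is handled afterwards through `hv`.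
  · have hrem : TendstoInMeasure μ (fun n ω => ((s n : ℂ) * (drawCharFun π Y n ω - 1) - g n ω) +
        (((((n : ℝ) ^ 2)⁻¹ * ∑ i ∈ Finset.range n, f (Z i ω) ^ 2 / π n i ω) - v) / 2 : ℝ)) atTop
        (fun _ => 0) := by
      refine TendstoInMeasure.zero_of_boundedInProb hW fun K hK =>
        ⟨fun n ω => 4 • fullMean Z
          (fun z => K * f z ^ 2 * min 1 (K * (√(s n))⁻¹ * |f z|)) n ω, ?_, ?_⟩
      · have hhm : ∀ n, Measurable fun z => K * f z ^ 2 * min 1 (K * (√(s n))⁻¹ * |f z|) :=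
          fun n => by fun_prop
        refine ((tendstoInMeasure_fullMean_zero (P := P) hZ hlaw hhm ?_).zero_const_smul
          4).congr_left (fun n => ae_of_all _ fun ω => by simp)
        have hz : ∫⁻ _ : 𝒵, (0 : ENNReal) ∂P = 0 := by simp
        rw [← hz]
        -- The Lindeberg integrand tends to zero pointwise and is dominated by K f².
        refine tendsto_lintegral_of_dominated_convergence
          (fun z => ENNReal.ofReal (K * f z ^ 2)) (fun n => by fun_prop) (fun n => ?_) ?_ ?_
        · refine ae_of_all _ fun z => ENNReal.ofReal_le_ofReal ?_
          rw [Real.norm_of_nonneg (by positivity)]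
          exact mul_le_of_le_one_right (by positivity) (min_le_left _ _)
        · exact (hf2.integrable_sq.const_mul K).lintegral_lt_top.ne
        · refine ae_of_all _ fun z => ?_
          rw [← ENNReal.ofReal_zero]
          refine (ENNReal.continuous_ofReal.tendsto 0).comp ?_
          rw [← norm_zero (E := ℝ)]
          refine Tendsto.norm ?_
          have h1 : Tendsto (fun n => K * (√(s n : ℝ))⁻¹ * |f z|) atTop (𝓝 0) := by
            simpa using (hsq.const_mul K).mul_const |f z|
          have h2 : Tendsto (fun n => min 1 (K * (√(s n : ℝ))⁻¹ * |f z|)) atTop (𝓝 0) := by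
            simpa using (tendsto_const_nhds (x := (1 : ℝ))).min h1
          simpa using h2.const_mul (K * f z ^ 2)
      · filter_upwards [eventually_ge_atTop 1, hs.eventually_ge_atTop 1] with n hn hsn
        have hn0 : (0 : ℝ) < n := by exact_mod_cast hn
        have hs0 : (0 : ℝ) < s n := by exact_mod_cast hsn
        have hr0 : (0 : ℝ) < √(s n) := Real.sqrt_pos.2 hs0
        have hrr : √(s n) ^ 2 = s n := Real.sq_sqrt hs0.le
        filter_upwards [ae_forall_pos hπ, hπ.sum_eq_one n hn] with ω hpos hsum hK'
        have hexpand : ((s n : ℂ) * (drawCharFun π Y n ω - 1) - g n ω) +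
            (((((n : ℝ) ^ 2)⁻¹ * ∑ i ∈ Finset.range n, f (Z i ω) ^ 2 / π n i ω) - v) / 2 : ℝ)
            = ∑ i ∈ Finset.range n, ((s n * π n i ω : ℝ) : ℂ) *
              (Complex.exp (Y n i ω * Complex.I) - 1 - Y n i ω * Complex.I
                + (Y n i ω : ℂ) ^ 2 / 2) := by
          have h1 : ∑ i ∈ Finset.range n, (s n * π n i ω) * Y n i ω
              = √(s n) * fullMean Z f n ω := by
            simp only [fullMean, Finset.mul_sum]
            refine Finset.sum_congr rfl fun i hi => ?_
            have hp := hpos n i (by simpa using hi)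
            simp only [hY, smul_eq_mul]
            field_simp
          have h2 : ∑ i ∈ Finset.range n, (s n * π n i ω) * Y n i ω ^ 2
              = ((n : ℝ) ^ 2)⁻¹ * ∑ i ∈ Finset.range n, f (Z i ω) ^ 2 / π n i ω := by
            simp only [Finset.mul_sum]
            refine Finset.sum_congr rfl fun i hi => ?_
            have hp := hpos n i (by simpa using hi)
            simp only [hY, smul_eq_mul, mul_pow, hrr]
            field_simp
          simp only [hg]
          rw [drawCharFun_sub_one hsum, ← h1, ← h2]
          push_cast
          simp only [Finset.mul_sum, Finset.sum_mul, Finset.sum_div, sub_div]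
          have e : ∀ A B C D : ℂ, A - (B - D / 2) + (C - D / 2) = A - B + C := fun _ _ _ _ => by ring
          rw [e, ← Finset.sum_sub_distrib, ← Finset.sum_add_distrib]
          refine Finset.sum_congr rfl fun i _ => ?_
          ring
        rw [hexpand]
        refine (norm_sum_le _ _).trans ((Finset.sum_le_sum (g := fun i =>
          (4 * (n : ℝ)⁻¹) * (K * f (Z i ω) ^ 2 * min 1 (K * (√(s n))⁻¹ * |f (Z i ω)|)))
            fun i hi => ?_).trans ?_)
        · have hp := hpos n i (by simpa using hi)
          have hKi := inv_le_iSup_inv (by simpa using hi) hK'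
          have habs : |Y n i ω| ≤ K * (√(s n))⁻¹ * |f (Z i ω)| := by
            simp only [hY, smul_eq_mul, abs_mul, abs_of_pos hr0]
            rw [abs_of_pos (by positivity)]
            calc √(s n) * (((n : ℝ) * s n * π n i ω)⁻¹ * |f (Z i ω)|)
                = ((n : ℝ) * π n i ω)⁻¹ * (√(s n))⁻¹ * |f (Z i ω)| := by
                  field_simp; rw [hrr]
              _ ≤ _ := by gcongr
          have hsqr : s n * π n i ω * Y n i ω ^ 2 ≤ (n : ℝ)⁻¹ * (K * f (Z i ω) ^ 2) := by
            calc s n * π n i ω * Y n i ω ^ 2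
                = (n : ℝ)⁻¹ * (((n : ℝ) * π n i ω)⁻¹ * f (Z i ω) ^ 2) := by
                  simp only [hY, smul_eq_mul, mul_pow, hrr]; field_simp
              _ ≤ _ := by gcongr
          rw [norm_mul, Complex.norm_real, Real.norm_of_nonneg (by positivity)]
          calc s n * π n i ω * _ ≤ s n * π n i ω * (4 * (Y n i ω ^ 2 * min 1 |Y n i ω|)) := by
                gcongr
                exact norm_exp_mul_I_sub_taylor_two_le _
            _ = 4 * ((s n * π n i ω * Y n i ω ^ 2) * min 1 |Y n i ω|) := by ring
            _ ≤ 4 * (((n : ℝ)⁻¹ * (K * f (Z i ω) ^ 2)) *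
                  min 1 (K * (√(s n))⁻¹ * |f (Z i ω)|)) := by gcongr
            _ = _ := by ring
        · refine le_trans (le_of_eq ?_) (le_abs_self _)
          rw [← Finset.mul_sum, fullMean, nsmul_eq_mul, mul_assoc]
          push_cast
          rfl
    have hv' := ((tendstoInMeasure_sub_const_iff.2 hv).zero_const_smul (-1 / 2))
    have hv'' : TendstoInMeasure μ (fun (n : ℕ) ω => ((-1 / 2 : ℝ) •
        ((((n : ℝ) ^ 2)⁻¹ * ∑ i ∈ Finset.range n, f (Z i ω) ^ 2 / π n i ω) - v) : ℂ)) atTop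
        (fun _ => 0) :=
      hv'.zero_of_le (Eventually.of_forall fun n => ae_of_all _ fun ω => le_of_eq (by
        rw [← Complex.norm_real]; congr 1; push_cast; simp))
    refine (hrem.zero_add hv'').congr_left fun n => ae_of_all _ fun ω => ?_
    simp only [Complex.real_smul]
    push_cast
    ring
  -- Divided by √s, the exponent becomes i times the full-data mean, which vanishes because `f` is
  -- centred, plus a null constant.
  · have h1 : TendstoInMeasure μ (fun n (_ : Ω) => (√(s n : ℝ))⁻¹ • (-(v / 2 : ℝ) : ℂ)) atTop
        (fun _ => 0) := tendstoInMeasure_zero_of_tendsto (by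
          simpa using hsq.smul_const (-(v / 2 : ℝ) : ℂ))
    have h2 : TendstoInMeasure μ (fun n ω => ((fullMean Z f n ω : ℝ) : ℂ) * Complex.I) atTop
        (fun _ => 0) := hmean.zero_of_le (Eventually.of_forall fun n => ae_of_all _ fun ω => by simp)
    refine (h2.zero_add h1).congr' ?_ EventuallyEq.rfl
    filter_upwards [hs.eventually_ge_atTop 1] with n hsn
    refine ae_of_all _ fun ω => ?_
    have hr0 : √(s n : ℝ) ≠ 0 := (Real.sqrt_pos.2 (by exact_mod_cast hsn)).ne'
    have hr' : ((√(s n : ℝ) : ℝ) : ℂ) ≠ 0 := by exact_mod_cast hr0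
    simp only [hg, Complex.real_smul]
    push_cast
    field_simp
    ring

/-- Central limit theorem for the weighted subsample mean of a centred function, in terms of
characteristic functions. -/
theorem tendsto_integral_exp_subMean (hZ : ∀ i, Measurable (Z i))
    (hlaw : ∀ i, μ.map (Z i) = P) (hind : iIndepFun Z μ) [IsProbabilityMeasure P]
    (hπ : IsSubsamplingDistribution μ Z π) (hI : IsSampledWithReplacement μ Z π s I)
    (hs : Tendsto s atTop atTop) {c : ℝ}
    (hc : Tendsto (fun n => (s n : ℝ) / (n : ℝ)) atTop (𝓝 c))
    (hW : BoundedInProb μ fun n ω => ⨆ i : Fin n, ((n : ℝ) * π n i ω)⁻¹)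
    {f : 𝒵 → ℝ} (hf2 : MemLp f 2 P) (hf0 : ∫ z, f z ∂P = 0) {v : ℝ} (hv0 : 0 ≤ v)
    (hv : TendstoInMeasure μ
      (fun (n : ℕ) ω => ((n : ℝ) ^ 2)⁻¹ * ∑ i ∈ Finset.range n, f (Z i ω) ^ 2 / π n i ω) atTop
      (fun _ => v)) :
    Tendsto (fun n => ∫ ω, Complex.exp ((√(s n) * subMean Z π I f n ω : ℝ) * Complex.I) ∂μ) atTop
      (𝓝 (Complex.exp (-(v + c * ∫ z, f z ^ 2 ∂P : ℝ) / 2))) := by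
  have hmk := hf2.1.ae_eq_mk
  have hdata := ae_forall_data (μ := μ) hZ hlaw hmk
  have h := tendsto_integral_exp_subMean_of_measurable hZ hlaw hind hπ hI hs hc hW
    hf2.1.stronglyMeasurable_mk.measurable (hf2.ae_eq hmk)
    (by rw [← integral_congr_ae hmk, hf0]) hv0
    (hv.congr_left fun n => by filter_upwards [hdata] with ω hω; simp only [hω])
  have e : ∫ z, hf2.1.mk f z ^ 2 ∂P = ∫ z, f z ^ 2 ∂P :=
    integral_congr_ae (by filter_upwards [hmk] with z hz; rw [← hz])
  rw [e] at h
  refine h.congr fun n => integral_congr_ae ?_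
  filter_upwards [ae_subMean_congr (I := I) (π := π) hZ hlaw hmk] with ω hω
  simp only [hω n]

end Subsample

/-! ### Localization of the maximizer of a concave function. -/

section Argmax

variable {E : Type*} [NormedAddCommGroup E] [NormedSpace ℝ E]

/-- The mean value inequality on the closed ball reaching exactly to `θ`, where the second
derivative stays within `η + L * ‖θ - θ₀‖` of `B`. -/
theorem norm_fderiv_sub_le_of_lipschitz {q : E → ℝ} {θ₀ θ : E} {δ L η : ℝ} {B : E →L[ℝ] E →L[ℝ] ℝ}
    (hdiff : ∀ x ∈ Metric.ball θ₀ δ, DifferentiableAt ℝ (fderiv ℝ q) x) (hL : 0 ≤ L)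
    (hlip : ∀ x ∈ Metric.ball θ₀ δ,
      ‖fderiv ℝ (fderiv ℝ q) x - fderiv ℝ (fderiv ℝ q) θ₀‖ ≤ L * ‖x - θ₀‖)
    (hη : ‖fderiv ℝ (fderiv ℝ q) θ₀ - B‖ ≤ η) (hθ : θ ∈ Metric.ball θ₀ δ) :
    ‖fderiv ℝ q θ - fderiv ℝ q θ₀ - B (θ - θ₀)‖ ≤ (η + L * ‖θ - θ₀‖) * ‖θ - θ₀‖ := by
  have hsub : Metric.closedBall θ₀ ‖θ - θ₀‖ ⊆ Metric.ball θ₀ δ :=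
    Metric.closedBall_subset_ball (by simpa [dist_eq_norm] using hθ)
  refine Convex.norm_image_sub_le_of_norm_fderiv_le' (𝕜 := ℝ) (s := Metric.closedBall θ₀ ‖θ - θ₀‖)
    (fun x hx => hdiff x (hsub hx)) (fun x hx => ?_) (convex_closedBall _ _)
    (Metric.mem_closedBall_self (norm_nonneg _)) (by simp [dist_eq_norm])
  have h1 := hlip x (hsub hx)
  have h2 : ‖x - θ₀‖ ≤ ‖θ - θ₀‖ := by simpa [dist_eq_norm] using hx
  have h3 := norm_sub_le_norm_sub_add_norm_sub (fderiv ℝ (fderiv ℝ q) x)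
    (fderiv ℝ (fderiv ℝ q) θ₀) B
  have h4 : L * ‖x - θ₀‖ ≤ L * ‖θ - θ₀‖ := by gcongr
  linarith

/-- Going from `x` back to `θ₀` leads away from the maximizer, and along that direction a concave
function cannot increase. -/
theorem fderiv_apply_nonneg_of_concaveOn {q : E → ℝ} {Θ : Set E} {θ₀ θ₁ x : E}
    (hconc : ConcaveOn ℝ Θ q) (hθ₀ : θ₀ ∈ Θ) (hθ₁ : θ₁ ∈ Θ) (hmax : IsMaxOn q Θ θ₁)
    (hx : x ∈ segment ℝ θ₀ θ₁) (hd : DifferentiableAt ℝ q x) :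
    0 ≤ fderiv ℝ q x (x - θ₀) := by
  have hxΘ : x ∈ Θ := hconc.1.segment_subset hθ₀ hθ₁ hx
  have hmaxx : IsMaxOn q (segment ℝ x θ₀) x := by
    intro y hy
    have hyΘ : y ∈ Θ := hconc.1.segment_subset hxΘ hθ₀ hy
    have hxy : x ∈ segment ℝ y θ₁ :=
      mem_segment_iff_wbtw.2 ((mem_segment_iff_wbtw.1 hx).trans_left_right
        (mem_segment_iff_wbtw.1 hy).symm)
    have h1 := hconc.min_le_of_mem_segment hyΘ hθ₁ hxy
    rwa [min_eq_left (show q y ≤ q θ₁ from hmax hyΘ)] at h1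
  have h3 := IsLocalMaxOn.hasFDerivWithinAt_nonpos hmaxx.localize
    hd.hasFDerivAt.hasFDerivWithinAt (mem_posTangentConeAt_of_segment_subset (y := θ₀ - x)
      (by rw [add_sub_cancel]))
  rw [← neg_sub, map_neg] at h3
  linarith

/-- A concave function whose gradient at `θ₀` is small and whose Hessian near `θ₀` is close to a
negative definite form has its maximizer close to `θ₀`, up to a quadratic error at the
Newton step. -/
theorem norm_argmax_sub_le {q : E → ℝ} {Θ : Set E} {θ₀ θ₁ : E} {δ ρ L η lam : ℝ}
    {B : E →L[ℝ] E →L[ℝ] ℝ} (hconc : ConcaveOn ℝ Θ q) (hball : Metric.ball θ₀ δ ⊆ Θ)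
    (hdiff1 : ∀ x ∈ Metric.ball θ₀ δ, DifferentiableAt ℝ q x)
    (hdiff : ∀ x ∈ Metric.ball θ₀ δ, DifferentiableAt ℝ (fderiv ℝ q) x) (hL : 0 ≤ L)
    (hlip : ∀ x ∈ Metric.ball θ₀ δ,
      ‖fderiv ℝ (fderiv ℝ q) x - fderiv ℝ (fderiv ℝ q) θ₀‖ ≤ L * ‖x - θ₀‖)
    (hη : ‖fderiv ℝ (fderiv ℝ q) θ₀ - B‖ ≤ η)
    (hθ₁ : θ₁ ∈ Θ) (hmax : IsMaxOn q Θ θ₁) (hlam : 0 < lam)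
    (hB : ∀ x, B x x ≤ -(lam * ‖x‖ ^ 2)) (hηl : η ≤ lam / 4) (hρ : 0 < ρ) (hρδ : ρ < δ)
    (hLρ : L * ρ ≤ lam / 4) (hS : ‖fderiv ℝ q θ₀‖ < lam * ρ / 2) :
    ‖θ₁ - θ₀‖ ≤ 2 / lam * ‖fderiv ℝ q θ₀‖ ∧
      ‖fderiv ℝ q θ₀ + B (θ₁ - θ₀)‖ ≤ (η + L * ‖θ₁ - θ₀‖) * ‖θ₁ - θ₀‖ := by
  have hθ₀ : θ₀ ∈ Θ := hball (Metric.mem_ball_self (hρ.trans hρδ))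
  have hexp := fun θ hθ => norm_fderiv_sub_le_of_lipschitz (θ := θ) hdiff hL hlip hη hθ
  -- The radial derivative is at most its value for the quadratic model with form `B`, plus the
  -- expansion error.
  have hval : ∀ θ ∈ Metric.ball θ₀ δ, fderiv ℝ q θ (θ - θ₀) ≤
      ‖fderiv ℝ q θ₀‖ * ‖θ - θ₀‖ - lam * ‖θ - θ₀‖ ^ 2
        + (η + L * ‖θ - θ₀‖) * ‖θ - θ₀‖ ^ 2 := by
    intro θ hθ
    have h1 := (le_abs_self _).trans
      (((fderiv ℝ q θ - fderiv ℝ q θ₀ - B (θ - θ₀)).le_opNorm (θ - θ₀)).trans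
        (mul_le_mul_of_nonneg_right (hexp θ hθ) (norm_nonneg _)))
    have h2 := (le_abs_self _).trans ((fderiv ℝ q θ₀).le_opNorm (θ - θ₀))
    have h3 := hB (θ - θ₀)
    simp only [sub_apply] at h1
    nlinarith
  -- Otherwise the segment to `θ₁` meets the sphere of radius `ρ`. There concavity makes the radial
  -- derivative nonnegative, while `hval` bounds it by ρ(‖gradient at θ₀‖ - lam ρ / 2) < 0.
  have hlt : ‖θ₁ - θ₀‖ < ρ := by
    by_contra hcon
    push Not at hcon
    have hpos : 0 < ‖θ₁ - θ₀‖ := hρ.trans_le hcon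
    set t := ρ / ‖θ₁ - θ₀‖ with ht
    have ht0 : 0 < t := by positivity
    have ht1 : t ≤ 1 := (div_le_one hpos).2 hcon
    set x := θ₀ + t • (θ₁ - θ₀) with hx
    have hxn : ‖x - θ₀‖ = ρ := by
      rw [hx, add_sub_cancel_left, norm_smul, Real.norm_of_nonneg ht0.le, ht,
        div_mul_cancel₀ _ hpos.ne']
    have hxb : x ∈ Metric.ball θ₀ δ := by simpa [dist_eq_norm, hxn] using hρδ
    have hxs : x ∈ segment ℝ θ₀ θ₁ := by
      rw [segment_eq_image']
      exact ⟨t, ⟨ht0.le, ht1⟩, rfl⟩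
    have h1 := fderiv_apply_nonneg_of_concaveOn hconc hθ₀ hθ₁ hmax hxs (hdiff1 x hxb)
    have h2 := hval x hxb
    rw [hxn] at h2
    have h3 : (η + L * ρ) * ρ ^ 2 ≤ (lam / 2) * ρ ^ 2 := by
      gcongr
      linarith
    have h4 : ‖fderiv ℝ q θ₀‖ * ρ < lam * ρ / 2 * ρ := by gcongr
    nlinarith
  have hθ₁b : θ₁ ∈ Metric.ball θ₀ δ := by
    simpa [dist_eq_norm] using hlt.trans hρδ
  have hzero : fderiv ℝ q θ₁ = 0 :=
    (hmax.isLocalMax (mem_of_superset (Metric.isOpen_ball.mem_nhds hθ₁b) hball)).fderiv_eq_zero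
  constructor
  · have h1 := hval θ₁ hθ₁b
    rw [hzero, zero_apply] at h1
    have h2 : L * ‖θ₁ - θ₀‖ ≤ L * ρ := by gcongr
    have h3 : (η + L * ‖θ₁ - θ₀‖) * ‖θ₁ - θ₀‖ ^ 2 ≤ (lam / 2) * ‖θ₁ - θ₀‖ ^ 2 := by
      gcongr
      linarith
    rcases (norm_nonneg (θ₁ - θ₀)).eq_or_lt with h0 | h0
    · rw [← h0]; positivity
    · rw [div_mul_eq_mul_div, le_div_iff₀ hlam]
      have h4 : (lam / 2 * ‖θ₁ - θ₀‖) * ‖θ₁ - θ₀‖ ≤ ‖fderiv ℝ q θ₀‖ * ‖θ₁ - θ₀‖ := by nlinarith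
      have h5 := le_of_mul_le_mul_right h4 h0
      linarith
  · have h1 := hexp θ₁ hθ₁b
    rw [hzero, zero_sub, ← neg_add', norm_neg] at h1
    exact h1

end Argmax

/-! ### Coordinates for linear and bilinear maps on Euclidean space. -/

section Euclidean

variable {d : ℕ}

theorem sum_smul_single (x : EuclideanSpace ℝ (Fin d)) :
    ∑ k, x k • EuclideanSpace.single k (1 : ℝ) = x := by
  have h := (EuclideanSpace.basisFun (Fin d) ℝ).sum_repr x
  simpa using h

theorem bilin_apply_eq_sum (B : EuclideanSpace ℝ (Fin d) →L[ℝ] EuclideanSpace ℝ (Fin d) →L[ℝ] ℝ)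
    (x y : EuclideanSpace ℝ (Fin d)) :
    B x y = ∑ k, ∑ l, x k * y l * B (EuclideanSpace.single k 1) (EuclideanSpace.single l 1) := by
  conv_lhs => rw [← sum_smul_single x, ← sum_smul_single y]
  simp only [map_sum, map_smul, sum_apply, smul_apply,
    smul_eq_mul, Finset.mul_sum]
  rw [Finset.sum_comm]
  refine Finset.sum_congr rfl fun k _ => Finset.sum_congr rfl fun l _ => by ring

theorem norm_bilin_le_sum (B : EuclideanSpace ℝ (Fin d) →L[ℝ] EuclideanSpace ℝ (Fin d) →L[ℝ] ℝ) :
    ‖B‖ ≤ ∑ k, ∑ l, |B (EuclideanSpace.single k 1) (EuclideanSpace.single l 1)| := by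
  refine ContinuousLinearMap.opNorm_le_bound₂ _ (by positivity) fun x y => ?_
  rw [bilin_apply_eq_sum B x y]
  refine (norm_sum_le _ _).trans ?_
  rw [Finset.sum_mul, Finset.sum_mul]
  refine Finset.sum_le_sum fun k _ => (norm_sum_le _ _).trans ?_
  rw [Finset.sum_mul, Finset.sum_mul]
  refine Finset.sum_le_sum fun l _ => ?_
  rw [norm_mul, norm_mul, mul_assoc, mul_comm]
  have h1 := PiLp.norm_apply_le x k
  have h2 := PiLp.norm_apply_le y l
  rw [mul_comm, ← mul_assoc, Real.norm_eq_abs (B _ _), mul_comm _ |B _ _|, ← mul_assoc]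
  gcongr

/-- A linear map is a finite sum of fixed continuous linear functions of its values on the basis.
Two applications give measurability of the second derivative from that of the Hessian entries. -/
theorem aestronglyMeasurable_clm {α F : Type*} [MeasurableSpace α] {P : Measure α}
    [NormedAddCommGroup F] [NormedSpace ℝ F] {L : α → EuclideanSpace ℝ (Fin d) →L[ℝ] F}
    (h : ∀ k, AEStronglyMeasurable (fun z => L z (EuclideanSpace.single k 1)) P) :
    AEStronglyMeasurable L P := by
  have e : L = fun z => ∑ k, ContinuousLinearMap.smulRightL ℝ (EuclideanSpace ℝ (Fin d)) F
      (EuclideanSpace.proj k) (L z (EuclideanSpace.single k 1)) := by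
    ext z x
    conv_lhs => rw [← sum_smul_single x]
    simp
  rw [e]
  refine Finset.aestronglyMeasurable_fun_sum _ fun k _ => ?_
  exact (ContinuousLinearMap.continuous _).comp_aestronglyMeasurable (h k)

end Euclidean

/-! ### Differentiation of the population objective under the integral. -/

section Population

set_option maxSynthPendingDepth 3

variable {𝒵 : Type*} [MeasurableSpace 𝒵] {P : Measure 𝒵} [IsProbabilityMeasure P] {d : ℕ}
  {m : 𝒵 → EuclideanSpace ℝ (Fin d) → ℝ} {Θ : Set (EuclideanSpace ℝ (Fin d))}
  {θ₀ : EuclideanSpace ℝ (Fin d)} {ψ : 𝒵 → ℝ}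

theorem inner_gradient (f : EuclideanSpace ℝ (Fin d) → ℝ) (θ t : EuclideanSpace ℝ (Fin d)) :
    inner ℝ (gradient f θ) t = fderiv ℝ f θ t := by
  rw [gradient, InnerProductSpace.toDual_symm_apply]

theorem norm_gradient (f : EuclideanSpace ℝ (Fin d) → ℝ) (θ : EuclideanSpace ℝ (Fin d)) :
    ‖gradient f θ‖ = ‖fderiv ℝ f θ‖ := by
  rw [gradient, LinearIsometryEquiv.norm_map]

omit [MeasurableSpace 𝒵] in
theorem hasFDerivAt_of_contDiffOn (hm_diff : ∀ z, ContDiffOn ℝ 2 (m z) (interior Θ)) (z : 𝒵)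
    {θ : EuclideanSpace ℝ (Fin d)} (hθ : θ ∈ interior Θ) :
    HasFDerivAt (m z) (fderiv ℝ (m z) θ) θ ∧
      HasFDerivAt (fderiv ℝ (m z)) (fderiv ℝ (fderiv ℝ (m z)) θ) θ := by
  have h : ContDiffAt ℝ 2 (m z) θ := (hm_diff z).contDiffAt (isOpen_interior.mem_nhds hθ)
  refine ⟨(h.differentiableAt (by norm_num)).hasFDerivAt, ?_⟩
  have h1 : ContDiffAt ℝ 1 (fderiv ℝ (m z)) θ := h.fderiv_right (by norm_num)
  exact (h1.differentiableAt (by norm_num)).hasFDerivAt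

omit [MeasurableSpace 𝒵] in
theorem norm_fderiv_fderiv_sub_le
    (hH_lip : ∀ z, ∀ θ₁ ∈ interior Θ, ∀ θ₂ ∈ interior Θ, ∀ k l,
      |hessian (m z) θ₁ k l - hessian (m z) θ₂ k l| ≤ ψ z * ‖θ₁ - θ₂‖) (z : 𝒵)
    {θ₁ θ₂ : EuclideanSpace ℝ (Fin d)} (h₁ : θ₁ ∈ interior Θ) (h₂ : θ₂ ∈ interior Θ) :
    ‖fderiv ℝ (fderiv ℝ (m z)) θ₁ - fderiv ℝ (fderiv ℝ (m z)) θ₂‖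
      ≤ (d : ℝ) ^ 2 * |ψ z| * ‖θ₁ - θ₂‖ := by
  refine (norm_bilin_le_sum _).trans ?_
  calc _ ≤ ∑ _k : Fin d, ∑ _l : Fin d, |ψ z| * ‖θ₁ - θ₂‖ := by
        refine Finset.sum_le_sum fun k _ => Finset.sum_le_sum fun l _ => ?_
        refine (hH_lip z θ₁ h₁ θ₂ h₂ k l).trans ?_
        gcongr
        exact le_abs_self _
    _ = _ := by simp; ring

omit [IsProbabilityMeasure P] in
-- Each partial derivative is a pointwise limit of difference quotients, which are measurable in
-- `z`.
theorem aestronglyMeasurable_fderiv (hm_meas : ∀ θ ∈ Θ, AEStronglyMeasurable (fun z => m z θ) P)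
    (hm_diff : ∀ z, ContDiffOn ℝ 2 (m z) (interior Θ))
    {θ : EuclideanSpace ℝ (Fin d)} (hθ : θ ∈ interior Θ) :
    AEStronglyMeasurable (fun z => fderiv ℝ (m z) θ) P := by
  refine aestronglyMeasurable_clm fun k => ?_
  obtain ⟨ε, hε, hball⟩ := Metric.isOpen_iff.1 isOpen_interior θ hθ
  -- Starting the step sizes 1/(N + n) below `ε` keeps every difference quotient inside `Θ`.
  obtain ⟨N, hN⟩ := exists_nat_gt (1 / ε)
  set e : EuclideanSpace ℝ (Fin d) := EuclideanSpace.single k 1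
  have hN0 : (0 : ℝ) < N := lt_trans (by positivity) hN
  have hmem : ∀ n : ℕ, θ + ((N + n : ℕ) : ℝ)⁻¹ • e ∈ Θ := fun n => by
    refine interior_subset (hball ?_)
    have hle : (N : ℝ) ≤ ((N + n : ℕ) : ℝ) := by push_cast; linarith [Nat.cast_nonneg (α := ℝ) n]
    rw [Metric.mem_ball, dist_eq_norm, add_sub_cancel_left, norm_smul,
      Real.norm_of_nonneg (by positivity), PiLp.norm_single, norm_one, mul_one]
    refine lt_of_le_of_lt (inv_anti₀ hN0 hle) ?_
    rw [inv_lt_comm₀ hN0 hε]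
    simpa using hN
  refine aestronglyMeasurable_of_tendsto_ae atTop
    (f := fun n z => ((N + n : ℕ) : ℝ) • (m z (θ + ((N + n : ℕ) : ℝ)⁻¹ • e) - m z θ))
    (fun n => ((hm_meas _ (hmem n)).sub (hm_meas _ (interior_subset hθ))).const_smul ((N + n : ℕ) : ℝ))
    (ae_of_all _ fun z => ?_)
  have ht : Tendsto (fun n : ℕ => ((N + n : ℕ) : ℝ)) atTop atTop :=
    tendsto_natCast_atTop_atTop.comp (tendsto_add_atTop_nat N |>.congr fun n => by ring)
  exact (hasFDerivAt_of_contDiffOn hm_diff z hθ).1.lim e (tendsto_norm_atTop_atTop.comp ht)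

omit [IsProbabilityMeasure P] in
theorem aestronglyMeasurable_fderiv_fderiv
    (hH_meas : ∀ θ ∈ interior Θ, ∀ k l, AEStronglyMeasurable (fun z => hessian (m z) θ k l) P)
    {θ : EuclideanSpace ℝ (Fin d)} (hθ : θ ∈ interior Θ) :
    AEStronglyMeasurable (fun z => fderiv ℝ (fderiv ℝ (m z)) θ) P :=
  aestronglyMeasurable_clm fun k => aestronglyMeasurable_clm fun l => hH_meas θ hθ k l

/-- Differentiation of the population objective under the integral sign. -/
theorem hasFDerivAt_popObj (hθ₀ : θ₀ ∈ interior Θ)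
    (hm_sq : ∀ θ ∈ Θ, MemLp (fun z => m z θ) 2 P)
    (hm_diff : ∀ z, ContDiffOn ℝ 2 (m z) (interior Θ))
    (hH_sq : ∀ θ ∈ interior Θ, ∀ k l, MemLp (fun z => hessian (m z) θ k l) 2 P)
    (hψ : MemLp ψ 2 P)
    (hH_lip : ∀ z, ∀ θ₁ ∈ interior Θ, ∀ θ₂ ∈ interior Θ, ∀ k l,
      |hessian (m z) θ₁ k l - hessian (m z) θ₂ k l| ≤ ψ z * ‖θ₁ - θ₂‖)
    (hg_sq : MemLp (fun z => gradient (m z) θ₀) 2 P) :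
    (∀ᶠ θ in 𝓝 θ₀, HasFDerivAt (popObj P m) (∫ z, fderiv ℝ (m z) θ ∂P) θ) ∧
    HasFDerivAt (fun θ => ∫ z, fderiv ℝ (m z) θ ∂P) (∫ z, fderiv ℝ (fderiv ℝ (m z)) θ₀ ∂P) θ₀ ∧
    Integrable (fun z => fderiv ℝ (m z) θ₀) P ∧
    Integrable (fun z => fderiv ℝ (fderiv ℝ (m z)) θ₀) P := by
  obtain ⟨δ, hδ, hball⟩ := Metric.isOpen_iff.1 isOpen_interior θ₀ hθ₀
  have hD1m := fun θ hθ => aestronglyMeasurable_fderiv (P := P) (θ := θ)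
    (fun θ hθ => (hm_sq θ hθ).1) hm_diff hθ
  have hD2m := aestronglyMeasurable_fderiv_fderiv (P := P) (m := m)
    (fun θ hθ k l => (hH_sq θ hθ k l).1) hθ₀
  -- The Lipschitz condition gives one integrable majorant of the second derivative on the whole
  -- ball. By the mean value inequality it also yields a majorant of the first derivative.
  set b : 𝒵 → ℝ := fun z => ‖fderiv ℝ (fderiv ℝ (m z)) θ₀‖ + (d : ℝ) ^ 2 * |ψ z| * δ with hb
  have hD2int : Integrable (fun z => fderiv ℝ (fderiv ℝ (m z)) θ₀) P := by
    refine Integrable.mono' (g := fun z => ∑ k, ∑ l, |hessian (m z) θ₀ k l|) ?_ hD2m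
      (ae_of_all _ fun z => norm_bilin_le_sum _)
    exact integrable_finsetSum _ fun k _ => integrable_finsetSum _ fun l _ =>
      ((hH_sq θ₀ hθ₀ k l).integrable (by norm_num)).abs
  have hbint : Integrable b P :=
    hD2int.norm.add (((hψ.integrable (by norm_num)).abs.const_mul _).mul_const _)
  have hD2b : ∀ z, ∀ θ ∈ Metric.ball θ₀ δ, ‖fderiv ℝ (fderiv ℝ (m z)) θ‖ ≤ b z := by
    intro z θ hθ
    have h1 := norm_fderiv_fderiv_sub_le hH_lip z (hball hθ) hθ₀
    have h2 := norm_sub_norm_le (fderiv ℝ (fderiv ℝ (m z)) θ) (fderiv ℝ (fderiv ℝ (m z)) θ₀)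
    have h3 : ‖θ - θ₀‖ ≤ δ := by rw [← dist_eq_norm]; exact (Metric.mem_ball.1 hθ).le
    have h4 : (d : ℝ) ^ 2 * |ψ z| * ‖θ - θ₀‖ ≤ (d : ℝ) ^ 2 * |ψ z| * δ := by gcongr
    simp only [hb]
    linarith
  have hD1int₀ : Integrable (fun z => fderiv ℝ (m z) θ₀) P := by
    refine ((hg_sq.integrable (by norm_num)).norm).mono' (hD1m θ₀ hθ₀) (ae_of_all _ fun z => ?_)
    rw [norm_gradient]
  have hD1b : ∀ z, ∀ θ ∈ Metric.ball θ₀ δ,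
      ‖fderiv ℝ (m z) θ‖ ≤ ‖fderiv ℝ (m z) θ₀‖ + b z * δ := by
    intro z θ hθ
    have h1 := (convex_ball θ₀ δ).norm_image_sub_le_of_norm_fderiv_le (𝕜 := ℝ)
      (f := fderiv ℝ (m z)) (fun x hx =>
        (hasFDerivAt_of_contDiffOn hm_diff z (hball hx)).2.differentiableAt) (hD2b z)
      (Metric.mem_ball_self hδ) hθ
    have h2 := norm_sub_norm_le (fderiv ℝ (m z) θ) (fderiv ℝ (m z) θ₀)
    have h3 : ‖θ - θ₀‖ ≤ δ := by rw [← dist_eq_norm]; exact (Metric.mem_ball.1 hθ).le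
    have h5 : 0 ≤ b z := (norm_nonneg _).trans (hD2b z θ hθ)
    have h4 : b z * ‖θ - θ₀‖ ≤ b z * δ := by gcongr
    linarith
  refine ⟨?_, ?_, hD1int₀, hD2int⟩
  · filter_upwards [Metric.isOpen_ball.mem_nhds (Metric.mem_ball_self (x := θ₀) hδ)] with θ hθ
    refine hasFDerivAt_integral_of_dominated_of_fderiv_le (F := fun θ z => m z θ)
      (bound := fun z => ‖fderiv ℝ (m z) θ₀‖ + b z * δ) (Metric.isOpen_ball.mem_nhds hθ) ?_
      ((hm_sq θ (interior_subset (hball hθ))).integrable (by norm_num)) (hD1m θ (hball hθ))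
      (ae_of_all _ hD1b) (hD1int₀.norm.add (hbint.mul_const _))
      (ae_of_all _ fun z x hx => (hasFDerivAt_of_contDiffOn hm_diff z (hball hx)).1)
    filter_upwards [Metric.isOpen_ball.mem_nhds hθ] with x hx
    exact (hm_sq x (interior_subset (hball hx))).1
  · refine hasFDerivAt_integral_of_dominated_of_fderiv_le (F := fun θ z => fderiv ℝ (m z) θ)
      (bound := b) (Metric.isOpen_ball.mem_nhds (Metric.mem_ball_self hδ)) ?_ hD1int₀ hD2m
      (ae_of_all _ hD2b) hbint
      (ae_of_all _ fun z x hx => (hasFDerivAt_of_contDiffOn hm_diff z (hball hx)).2)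
    filter_upwards [Metric.isOpen_ball.mem_nhds (Metric.mem_ball_self (x := θ₀) hδ)] with x hx
    exact hD1m x (hball hx)

theorem hessian_popObj (hθ₀ : θ₀ ∈ interior Θ)
    (hm_sq : ∀ θ ∈ Θ, MemLp (fun z => m z θ) 2 P)
    (hm_diff : ∀ z, ContDiffOn ℝ 2 (m z) (interior Θ))
    (hH_sq : ∀ θ ∈ interior Θ, ∀ k l, MemLp (fun z => hessian (m z) θ k l) 2 P)
    (hψ : MemLp ψ 2 P)
    (hH_lip : ∀ z, ∀ θ₁ ∈ interior Θ, ∀ θ₂ ∈ interior Θ, ∀ k l,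
      |hessian (m z) θ₁ k l - hessian (m z) θ₂ k l| ≤ ψ z * ‖θ₁ - θ₂‖)
    (hg_sq : MemLp (fun z => gradient (m z) θ₀) 2 P) :
    hessian (popObj P m) θ₀ = expHessian P m θ₀ := by
  obtain ⟨h1, h2, -, h4⟩ := hasFDerivAt_popObj hθ₀ hm_sq hm_diff hH_sq hψ hH_lip hg_sq
  have h5 : fderiv ℝ (popObj P m) =ᶠ[𝓝 θ₀] fun θ => ∫ z, fderiv ℝ (m z) θ ∂P := by
    filter_upwards [h1] with θ hθ using hθ.fderiv
  have h6 := h5.fderiv_eq.trans h2.fderiv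
  ext k l
  simp only [hessian, expHessian, Matrix.of_apply]
  rw [h6, ContinuousLinearMap.integral_apply h4,
    ContinuousLinearMap.integral_apply (h4.apply_continuousLinearMap _)]

theorem integral_inner_gradient_eq_zero (hθ₀ : θ₀ ∈ interior Θ)
    (hm_sq : ∀ θ ∈ Θ, MemLp (fun z => m z θ) 2 P)
    (hm_diff : ∀ z, ContDiffOn ℝ 2 (m z) (interior Θ))
    (hH_sq : ∀ θ ∈ interior Θ, ∀ k l, MemLp (fun z => hessian (m z) θ k l) 2 P)
    (hψ : MemLp ψ 2 P)
    (hH_lip : ∀ z, ∀ θ₁ ∈ interior Θ, ∀ θ₂ ∈ interior Θ, ∀ k l,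
      |hessian (m z) θ₁ k l - hessian (m z) θ₂ k l| ≤ ψ z * ‖θ₁ - θ₂‖)
    (hg_sq : MemLp (fun z => gradient (m z) θ₀) 2 P) (hmax : IsMaxOn (popObj P m) Θ θ₀)
    (t : EuclideanSpace ℝ (Fin d)) : ∫ z, inner ℝ (gradient (m z) θ₀) t ∂P = 0 := by
  obtain ⟨h1, -, h3, -⟩ := hasFDerivAt_popObj hθ₀ hm_sq hm_diff hH_sq hψ hH_lip hg_sq
  have hloc : IsLocalMax (popObj P m) θ₀ :=
    hmax.isLocalMax (mem_interior_iff_mem_nhds.1 hθ₀)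
  have h4 := hloc.hasFDerivAt_eq_zero h1.self_of_nhds
  simp only [inner_gradient]
  rw [← ContinuousLinearMap.integral_apply h3, h4, zero_apply]

end Population

set_option maxSynthPendingDepth 3

/-! ### Quadratic forms of matrices. -/

section Matrices

variable {d : ℕ}

theorem dotProduct_mulVec_eq_sum (S : Matrix (Fin d) (Fin d) ℝ) (t u : Fin d → ℝ) :
    t ⬝ᵥ S.mulVec u = ∑ k, ∑ l, t k * u l * S k l := by
  simp only [dotProduct, Matrix.mulVec, Finset.mul_sum]
  exact Finset.sum_congr rfl fun k _ => Finset.sum_congr rfl fun l _ => by ring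

theorem inner_gradient_sq (f : EuclideanSpace ℝ (Fin d) → ℝ) (θ t : EuclideanSpace ℝ (Fin d)) :
    inner ℝ (gradient f θ) t ^ 2 = ∑ k, ∑ l, t k * t l * gradOuter f θ k l := by
  simp only [gradOuter, Matrix.of_apply, PiLp.inner_apply, RCLike.inner_apply, conj_trivial]
  rw [sq, Finset.sum_mul_sum]
  exact Finset.sum_congr rfl fun k _ => Finset.sum_congr rfl fun l _ => by ring

theorem exists_pos_le_of_posDef {S : Matrix (Fin d) (Fin d) ℝ} (hS : S.PosDef) :
    ∃ lam : ℝ, 0 < lam ∧ ∀ x : EuclideanSpace ℝ (Fin d), lam * ‖x‖ ^ 2 ≤ x.ofLp ⬝ᵥ S.mulVec x.ofLp := by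
  have hpos : ∀ x : EuclideanSpace ℝ (Fin d), x ≠ 0 → 0 < x.ofLp ⬝ᵥ S.mulVec x.ofLp := by
    intro x hx
    have := hS.dotProduct_mulVec_pos (x := x.ofLp) (by simpa using hx)
    simpa using this
  -- The unit sphere is empty in dimension zero. Otherwise the constant is the minimum of the form
  -- on it.
  rcases (Metric.sphere (0 : EuclideanSpace ℝ (Fin d)) 1).eq_empty_or_nonempty with he | hne
  · refine ⟨1, one_pos, fun x => ?_⟩
    have hx : x = 0 := by
      by_contra hx
      have : (‖x‖⁻¹ • x) ∈ Metric.sphere (0 : EuclideanSpace ℝ (Fin d)) 1 := by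
        simp [norm_smul, hx]
      rw [he] at this
      exact this
    simp [hx]
  · have hcont : Continuous fun x : EuclideanSpace ℝ (Fin d) => x.ofLp ⬝ᵥ S.mulVec x.ofLp := by
      simp only [dotProduct_mulVec_eq_sum]
      fun_prop
    obtain ⟨x₀, hx₀, hmin⟩ := (isCompact_sphere (0 : EuclideanSpace ℝ (Fin d)) 1).exists_isMinOn
      hne hcont.continuousOn
    refine ⟨_, hpos x₀ (by
      rintro rfl
      simp at hx₀), fun x => ?_⟩
    rcases eq_or_ne x 0 with rfl | hx
    · simp
    have hxn : ‖x‖ ≠ 0 := norm_ne_zero_iff.2 hx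
    have h1 := hmin (show (‖x‖⁻¹ • x) ∈ Metric.sphere (0 : EuclideanSpace ℝ (Fin d)) 1 by
      simp [norm_smul, hx])
    simp only [Set.mem_ofPred_eq, WithLp.ofLp_smul, Matrix.mulVec_smul, dotProduct_smul,
      smul_dotProduct, smul_eq_mul] at h1
    calc _ ≤ (‖x‖⁻¹ * (‖x‖⁻¹ * x.ofLp ⬝ᵥ S.mulVec x.ofLp)) * ‖x‖ ^ 2 := by gcongr
      _ = _ := by field_simp

end Matrices

/-! ### The localization lemma for nonnegatively weighted sums of `m`. -/

section WeightedObjective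

variable {𝒵 : Type*} {d k : ℕ} {m : 𝒵 → EuclideanSpace ℝ (Fin d) → ℝ}
  {Θ : Set (EuclideanSpace ℝ (Fin d))} {w : Fin k → ℝ} {z : Fin k → 𝒵}

theorem concaveOn_weightedSum (hΘ : Convex ℝ Θ) (hconc : ∀ z, ConcaveOn ℝ Θ (m z))
    (hw : ∀ j, 0 ≤ w j) : ConcaveOn ℝ Θ fun θ => ∑ j, w j * m (z j) θ := by
  refine ⟨hΘ, fun x hx y hy a b ha hb hab => ?_⟩
  simp only [smul_eq_mul, Finset.mul_sum]
  rw [← Finset.sum_add_distrib]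
  refine Finset.sum_le_sum fun j _ => ?_
  have := mul_le_mul_of_nonneg_left ((hconc (z j)).2 hx hy ha hb hab) (hw j)
  simp only [smul_eq_mul] at this
  linarith

theorem hasFDerivAt_weightedSum (hm_diff : ∀ z, ContDiffOn ℝ 2 (m z) (interior Θ))
    {θ : EuclideanSpace ℝ (Fin d)} (hθ : θ ∈ interior Θ) :
    HasFDerivAt (fun θ => ∑ j, w j * m (z j) θ) (∑ j, w j • fderiv ℝ (m (z j)) θ) θ :=
  HasFDerivAt.fun_sum fun j _ => (hasFDerivAt_of_contDiffOn hm_diff (z j) hθ).1.const_mul (w j)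

theorem hasFDerivAt_fderiv_weightedSum (hm_diff : ∀ z, ContDiffOn ℝ 2 (m z) (interior Θ))
    {θ : EuclideanSpace ℝ (Fin d)} (hθ : θ ∈ interior Θ) :
    HasFDerivAt (fderiv ℝ fun θ => ∑ j, w j * m (z j) θ)
      (∑ j, w j • fderiv ℝ (fderiv ℝ (m (z j))) θ) θ := by
  have h : HasFDerivAt (fun θ => ∑ j, w j • fderiv ℝ (m (z j)) θ)
      (∑ j, w j • fderiv ℝ (fderiv ℝ (m (z j))) θ) θ :=
    HasFDerivAt.fun_sum fun j _ => (hasFDerivAt_of_contDiffOn hm_diff (z j) hθ).2.const_smul (w j)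
  refine h.congr_of_eventuallyEq ?_
  filter_upwards [isOpen_interior.mem_nhds hθ] with x hx
  exact (hasFDerivAt_weightedSum hm_diff hx).fderiv

/-- One-step expansion of the maximizer of a weighted objective around `θ₀`. -/
theorem norm_argmax_weightedSum_sub_le {θ₀ θ₁ : EuclideanSpace ℝ (Fin d)} {ψ : 𝒵 → ℝ}
    {H : Matrix (Fin d) (Fin d) ℝ} {δ ρ lam : ℝ}
    (hconc : ∀ z, ConcaveOn ℝ Θ (m z)) (hw : ∀ j, 0 ≤ w j) (hΘ : Convex ℝ Θ)
    (hball : Metric.ball θ₀ δ ⊆ interior Θ) (hθ₀ : θ₀ ∈ interior Θ)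
    (hm_diff : ∀ z, ContDiffOn ℝ 2 (m z) (interior Θ))
    (hH_lip : ∀ z, ∀ θ₁ ∈ interior Θ, ∀ θ₂ ∈ interior Θ, ∀ k l,
      |hessian (m z) θ₁ k l - hessian (m z) θ₂ k l| ≤ ψ z * ‖θ₁ - θ₂‖)
    (hHsymm : H.transpose = H) (hlam : 0 < lam)
    (hH : ∀ x : EuclideanSpace ℝ (Fin d), lam * ‖x‖ ^ 2 ≤ x.ofLp ⬝ᵥ (-H).mulVec x.ofLp)
    (hθ₁ : θ₁ ∈ Θ) (hmax : IsMaxOn (fun θ => ∑ j, w j * m (z j) θ) Θ θ₁)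
    (hη : ∑ a, ∑ b, |∑ j, w j * hessian (m (z j)) θ₀ a b - H a b| ≤ lam / 4)
    (hρ : 0 < ρ) (hρδ : ρ < δ) (hLρ : (d : ℝ) ^ 2 * (∑ j, w j * |ψ (z j)|) * ρ ≤ lam / 4)
    (hS : ‖∑ j, w j • gradient (m (z j)) θ₀‖ < lam * ρ / 2) :
    ‖θ₁ - θ₀‖ ≤ 2 / lam * ‖∑ j, w j • gradient (m (z j)) θ₀‖ ∧
    ‖∑ j, w j • gradient (m (z j)) θ₀ + Matrix.toEuclideanCLM (𝕜 := ℝ) H (θ₁ - θ₀)‖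
      ≤ (∑ a, ∑ b, |∑ j, w j * hessian (m (z j)) θ₀ a b - H a b|
          + (d : ℝ) ^ 2 * (∑ j, w j * |ψ (z j)|) * ‖θ₁ - θ₀‖) * ‖θ₁ - θ₀‖ := by
  set A := Matrix.toEuclideanCLM (𝕜 := ℝ) H with hA
  set B : EuclideanSpace ℝ (Fin d) →L[ℝ] EuclideanSpace ℝ (Fin d) →L[ℝ] ℝ :=
    (innerSL ℝ : EuclideanSpace ℝ (Fin d) →L[ℝ] EuclideanSpace ℝ (Fin d) →L[ℝ] ℝ).comp A with hBdef
  have hBapp : ∀ x y, B x y = inner ℝ (A x) y := fun x y => rfl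
  have hBsum : ∀ x y, B x y = ∑ a, ∑ b, y a * x b * H a b := fun x y => by
    rw [hBapp, real_inner_comm, Matrix.inner_toEuclideanCLM, dotProduct_mulVec_eq_sum]
  have hf1 : fderiv ℝ (fun θ => ∑ j, w j * m (z j) θ) θ₀
      = innerSL ℝ (∑ j, w j • gradient (m (z j)) θ₀) := by
    rw [(hasFDerivAt_weightedSum hm_diff hθ₀).fderiv]
    ext v
    simp only [sum_apply, smul_apply, innerSL_apply_apply, sum_inner, inner_smul_left,
      inner_gradient, smul_eq_mul, conj_trivial]
  have hf2 := fun θ hθ => (hasFDerivAt_fderiv_weightedSum (w := w) (z := z) (θ := θ) hm_diff hθ).fderiv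
  have key := norm_argmax_sub_le (q := fun θ => ∑ j, w j * m (z j) θ) (Θ := Θ) (θ₀ := θ₀) (θ₁ := θ₁)
    (δ := δ) (ρ := ρ) (L := (d : ℝ) ^ 2 * (∑ j, w j * |ψ (z j)|))
    (η := ∑ a, ∑ b, |∑ j, w j * hessian (m (z j)) θ₀ a b - H a b|) (lam := lam) (B := B)
    (concaveOn_weightedSum hΘ hconc hw) (hball.trans interior_subset)
    (fun x hx => (hasFDerivAt_weightedSum hm_diff (hball hx)).differentiableAt)
    (fun x hx => (hasFDerivAt_fderiv_weightedSum hm_diff (hball hx)).differentiableAt)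
    (mul_nonneg (by positivity) (Finset.sum_nonneg fun j _ => mul_nonneg (hw j) (abs_nonneg _)))
    ?_ ?_ hθ₁ hmax hlam ?_ hη hρ hρδ hLρ ?_
  · rw [hf1, innerSL_apply_norm] at key
    refine ⟨key.1, ?_⟩
    have e : innerSL ℝ (∑ j, w j • gradient (m (z j)) θ₀) + B (θ₁ - θ₀)
        = innerSL ℝ (∑ j, w j • gradient (m (z j)) θ₀ + A (θ₁ - θ₀)) := by
      ext v
      simp [hBapp]
    rw [e, innerSL_apply_norm] at key
    exact key.2
  · intro x hx
    rw [hf2 x (hball hx), hf2 θ₀ hθ₀, ← Finset.sum_sub_distrib]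
    refine (norm_sum_le _ _).trans ?_
    rw [Finset.mul_sum, Finset.sum_mul]
    refine Finset.sum_le_sum fun j _ => ?_
    rw [← smul_sub, norm_smul, Real.norm_of_nonneg (hw j)]
    have := mul_le_mul_of_nonneg_left
      (norm_fderiv_fderiv_sub_le hH_lip (z j) (hball hx) hθ₀) (hw j)
    linarith
  · refine (norm_bilin_le_sum _).trans (le_of_eq ?_)
    refine Finset.sum_congr rfl fun a _ => Finset.sum_congr rfl fun b _ => ?_
    rw [hf2 θ₀ hθ₀, sub_apply, sub_apply, hBsum]
    congr 2
    · simp [hessian, sum_apply]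
    -- On basis vectors `B` returns the transposed entry of `H`, so symmetry is needed here.
    · rw [← congrFun (congrFun hHsymm a) b, Matrix.transpose_apply]
      simp
  · intro x
    have h1 := hH x
    rw [hBsum, ← dotProduct_mulVec_eq_sum]
    rw [Matrix.neg_mulVec, dotProduct_neg] at h1
    linarith
  · rw [hf1, innerSL_apply_norm]
    exact hS

end WeightedObjective

/-! ### Limit law of the score and asymptotic linearity of the estimator. -/

section Assembly

/-- A bound valid only where `e n` is small is enough, because that event has probability tending to
one. -/
theorem _root_.MeasureTheory.TendstoInMeasure.zero_of_le_of_small {Ω E : Type*} [MeasurableSpace Ω]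
    {μ : Measure Ω} [SeminormedAddCommGroup E] {f : ℕ → Ω → E} {e g : ℕ → Ω → ℝ} {κ : ℝ}
    (hκ : 0 < κ) (he : TendstoInMeasure μ e atTop (fun _ => 0))
    (hg : TendstoInMeasure μ g atTop (fun _ => 0))
    (h : ∀ᶠ n in atTop, ∀ᵐ ω ∂μ, |e n ω| < κ → ‖f n ω‖ ≤ g n ω) :
    TendstoInMeasure μ f atTop (fun _ => 0) := by
  rw [tendstoInMeasure_zero_iff] at he hg ⊢
  intro ε hε
  have := (he κ hκ).add (hg ε hε)
  rw [add_zero] at this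
  refine tendsto_of_tendsto_of_tendsto_of_le_of_le' tendsto_const_nhds this
    (Eventually.of_forall fun _ => zero_le) ?_
  filter_upwards [h] with n hn
  refine le_trans (measure_mono_ae ?_) (measure_union_le _ _)
  filter_upwards [hn] with ω hω hf
  by_cases hκω : |e n ω| < κ
  · exact Or.inr ((show ε ≤ ‖f n ω‖ from hf).trans ((hω hκω).trans (le_abs_self _)))
  · exact Or.inl (not_lt.1 hκω)

variable {Ω 𝒵 : Type*} [MeasurableSpace Ω] [MeasurableSpace 𝒵] {μ : Measure Ω}
  [IsProbabilityMeasure μ] {P : Measure 𝒵} [IsProbabilityMeasure P] {d : ℕ} {Z : ℕ → Ω → 𝒵}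
  {π : ℕ → ℕ → Ω → ℝ} {s : ℕ → ℕ} {I : (n : ℕ) → Fin (s n) → Ω → ℕ}
  {m : 𝒵 → EuclideanSpace ℝ (Fin d) → ℝ} {θ₀ : EuclideanSpace ℝ (Fin d)}

omit [IsProbabilityMeasure P] in
theorem integral_inner_gradient_sq (hg_sq : MemLp (fun z => gradient (m z) θ₀) 2 P)
    (t : EuclideanSpace ℝ (Fin d)) :
    ∫ z, inner ℝ (gradient (m z) θ₀) t ^ 2 ∂P = t.ofLp ⬝ᵥ (Lam P m θ₀).mulVec t.ofLp := by
  have hk : ∀ k, MemLp (fun z => gradient (m z) θ₀ k) 2 P := fun k =>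
    (EuclideanSpace.proj (𝕜 := ℝ) k : EuclideanSpace ℝ (Fin d) →L[ℝ] ℝ).comp_memLp' hg_sq
  have hkl : ∀ k l, Integrable (fun z => gradOuter (m z) θ₀ k l) P := fun k l =>
    (hk k).integrable_mul (hk l)
  simp only [inner_gradient_sq, dotProduct_mulVec_eq_sum]
  rw [integral_finsetSum _ fun k _ => integrable_finsetSum _ fun l _ => (hkl k l).const_mul _]
  refine Finset.sum_congr rfl fun k _ => ?_
  rw [integral_finsetSum _ fun l _ => (hkl k l).const_mul _]
  refine Finset.sum_congr rfl fun l _ => ?_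
  rw [integral_const_mul]
  rfl

omit [IsProbabilityMeasure μ] [MeasurableSpace 𝒵] in
theorem tendstoInMeasure_quadratic_LamR {Λπ : Matrix (Fin d) (Fin d) ℝ}
    (hΛπ : ∀ k l, TendstoInMeasure μ (fun n ω => LamR m Z π n ω θ₀ k l) atTop (fun _ => Λπ k l))
    (t : EuclideanSpace ℝ (Fin d)) :
    TendstoInMeasure μ (fun (n : ℕ) ω => ((n : ℝ) ^ 2)⁻¹ *
      ∑ i ∈ Finset.range n, inner ℝ (gradient (m (Z i ω)) θ₀) t ^ 2 / π n i ω) atTop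
      (fun _ => t.ofLp ⬝ᵥ Λπ.mulVec t.ofLp) := by
  rw [← tendstoInMeasure_sub_const_iff]
  have h := TendstoInMeasure.zero_sum (μ := μ) Finset.univ fun k _ =>
    TendstoInMeasure.zero_sum (μ := μ) Finset.univ fun l _ =>
      (tendstoInMeasure_sub_const_iff.2 (hΛπ k l)).zero_const_smul (t k * t l)
  refine h.congr_left fun n => ae_of_all _ fun ω => ?_
  simp only [dotProduct_mulVec_eq_sum, smul_eq_mul, mul_sub, Finset.sum_sub_distrib]
  congr 1
  simp only [LamR, Matrix.of_apply, inner_gradient_sq, Finset.mul_sum, Finset.sum_div]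
  conv_rhs => rw [Finset.sum_comm]
  refine Finset.sum_congr rfl fun k _ => ?_
  conv_rhs => rw [Finset.sum_comm]
  refine Finset.sum_congr rfl fun l _ => Finset.sum_congr rfl fun i _ => by ring

omit [MeasurableSpace Ω] [MeasurableSpace 𝒵] in
theorem inner_subMean (f : 𝒵 → EuclideanSpace ℝ (Fin d)) (t : EuclideanSpace ℝ (Fin d)) (n : ℕ)
    (ω : Ω) :
    inner ℝ (subMean Z π I f n ω) t = subMean Z π I (fun z => inner ℝ (f z) t) n ω := by
  simp only [subMean, sum_inner, inner_smul_left, conj_trivial, smul_eq_mul]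

/-- The rescaled weighted subsample sum of gradients at `θ₀`. -/
noncomputable def subScore (m : 𝒵 → EuclideanSpace ℝ (Fin d) → ℝ) (Z : ℕ → Ω → 𝒵)
    (π : ℕ → ℕ → Ω → ℝ) (I : (n : ℕ) → Fin (s n) → Ω → ℕ) (θ₀ : EuclideanSpace ℝ (Fin d)) (n : ℕ)
    (ω : Ω) : EuclideanSpace ℝ (Fin d) :=
  √(s n) • drawSum I n (fun i ω => ((n : ℝ) * s n * π n i ω)⁻¹ • gradient (m (Z i ω)) θ₀) ω

omit [MeasurableSpace Ω] [MeasurableSpace 𝒵] in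
theorem subScore_eq {n : ℕ} {ω : Ω} (h : ∀ j, I n j ω < n) :
    subScore m Z π I θ₀ n ω = √(s n) • subMean Z π I (fun z => gradient (m z) θ₀) n ω := by
  rw [subScore, drawSum_eq h]
  rfl

omit [IsProbabilityMeasure μ] [IsProbabilityMeasure P] in
theorem aemeasurable_subScore (hZ : ∀ i, Measurable (Z i)) (hlaw : ∀ i, μ.map (Z i) = P)
    (hπ : IsSubsamplingDistribution μ Z π) (hI : IsSampledWithReplacement μ Z π s I)
    (hg_sq : MemLp (fun z => gradient (m z) θ₀) 2 P) (n : ℕ) :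
    AEMeasurable (subScore m Z π I θ₀ n) μ := by
  have h : AEMeasurable (drawSum I n fun i ω =>
      ((n : ℝ) * s n * π n i ω)⁻¹ • gradient (m (Z i ω)) θ₀) μ := by
    refine aemeasurable_drawSum hI fun i hi => ?_
    have h1 : Measurable (π n i) := (hπ.measurable n i hi).mono (dataSigma_le hZ n) le_rfl
    have h2 : AEMeasurable (fun ω => gradient (m (Z i ω)) θ₀) μ := by
      have h := hg_sq.1.aemeasurable
      rw [← hlaw i] at h
      exact h.comp_measurable (hZ i)
    exact ((h1.const_mul _).inv.aemeasurable).smul h2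
  exact h.const_smul √(s n)

theorem tendsto_integral_exp_inner_subScore (hZ : ∀ i, Measurable (Z i))
    (hlaw : ∀ i, μ.map (Z i) = P) (hind : iIndepFun Z μ)
    (hπ : IsSubsamplingDistribution μ Z π) (hI : IsSampledWithReplacement μ Z π s I)
    (hs : Tendsto s atTop atTop) {c : ℝ}
    (hc : Tendsto (fun n => (s n : ℝ) / (n : ℝ)) atTop (𝓝 c))
    (hW : BoundedInProb μ fun n ω => ⨆ i : Fin n, ((n : ℝ) * π n i ω)⁻¹)
    (hg_sq : MemLp (fun z => gradient (m z) θ₀) 2 P)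
    (hg0 : ∀ t, ∫ z, inner ℝ (gradient (m z) θ₀) t ∂P = 0)
    {Λπ : Matrix (Fin d) (Fin d) ℝ} (hΛπ_pos : Λπ.PosSemidef)
    (hΛπ : ∀ k l, TendstoInMeasure μ (fun n ω => LamR m Z π n ω θ₀ k l) atTop (fun _ => Λπ k l))
    (t : EuclideanSpace ℝ (Fin d)) :
    Tendsto (fun n => ∫ ω, Complex.exp (inner ℝ (subScore m Z π I θ₀ n ω) t * Complex.I) ∂μ) atTop
      (𝓝 (Complex.exp (-(t.ofLp ⬝ᵥ (Λπ + c • Lam P m θ₀).mulVec t.ofLp : ℝ) / 2))) := by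
  have hv0 : 0 ≤ t.ofLp ⬝ᵥ Λπ.mulVec t.ofLp := by
    simpa using hΛπ_pos.dotProduct_mulVec_nonneg t.ofLp
  have h := tendsto_integral_exp_subMean hZ hlaw hind hπ hI hs hc hW
    (f := fun z => inner ℝ (gradient (m z) θ₀) t) (hg_sq.inner_const t) (hg0 t) hv0
    (tendstoInMeasure_quadratic_LamR hΛπ t)
  rw [integral_inner_gradient_sq hg_sq t] at h
  have e : t.ofLp ⬝ᵥ (Λπ + c • Lam P m θ₀).mulVec t.ofLp
      = t.ofLp ⬝ᵥ Λπ.mulVec t.ofLp + c * t.ofLp ⬝ᵥ (Lam P m θ₀).mulVec t.ofLp := by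
    rw [Matrix.add_mulVec, Matrix.smul_mulVec, dotProduct_add, dotProduct_smul, smul_eq_mul]
  rw [e]
  refine h.congr' ?_
  filter_upwards [eventually_ge_atTop 1] with n hn
  refine integral_congr_ae ?_
  filter_upwards [ae_draws_lt hZ hπ hI hn] with ω hω
  rw [subScore_eq hω, inner_smul_left, inner_subMean, conj_trivial]

set_option maxHeartbeats 800000 in
/-- Asymptotic linearity of the subsample estimator. -/
theorem tendstoInMeasure_argmax_add_newtonStep {Θ : Set (EuclideanSpace ℝ (Fin d))} {ψ : 𝒵 → ℝ}
    {H : Matrix (Fin d) (Fin d) ℝ} {θsub : ℕ → Ω → EuclideanSpace ℝ (Fin d)}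
    (hZ : ∀ i, Measurable (Z i))
    (hlaw : ∀ i, μ.map (Z i) = P) (hind : iIndepFun Z μ)
    (hπ : IsSubsamplingDistribution μ Z π) (hI : IsSampledWithReplacement μ Z π s I)
    (hs : Tendsto s atTop atTop)
    (hW : BoundedInProb μ fun n ω => ⨆ i : Fin n, ((n : ℝ) * π n i ω)⁻¹)
    (hθ₀ : θ₀ ∈ interior Θ) (hconc : ∀ z, ConcaveOn ℝ Θ (m z))
    (hm_diff : ∀ z, ContDiffOn ℝ 2 (m z) (interior Θ))
    (hH_pos : (-H).PosDef) (hH_eq : expHessian P m θ₀ = H)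
    (hH_sq : ∀ k l, MemLp (fun z => hessian (m z) θ₀ k l) 2 P)
    (hψ : MemLp ψ 2 P)
    (hH_lip : ∀ z, ∀ θ₁ ∈ interior Θ, ∀ θ₂ ∈ interior Θ, ∀ k l,
      |hessian (m z) θ₁ k l - hessian (m z) θ₂ k l| ≤ ψ z * ‖θ₁ - θ₂‖)
    (hV : BoundedInProb μ fun n ω => ‖subScore m Z π I θ₀ n ω‖)
    (hθsub : ∀ n, ∀ᵐ ω ∂μ, θsub n ω ∈ Θ ∧ IsMaxOn (subObj m Z π s I n ω) Θ (θsub n ω)) :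
    TendstoInMeasure μ (fun n ω => √(s n) • (θsub n ω - θ₀)
      + Matrix.toEuclideanCLM (𝕜 := ℝ) H⁻¹ (subScore m Z π I θ₀ n ω)) atTop (fun _ => 0) := by
  obtain ⟨lam, hlam, hlamH⟩ := exists_pos_le_of_posDef hH_pos
  obtain ⟨δ, hδ, hball⟩ := Metric.isOpen_iff.1 isOpen_interior θ₀ hθ₀
  have hHsymm : H.transpose = H := by
    have := hH_pos.isHermitian.neg
    rw [neg_neg] at this
    simpa [Matrix.IsHermitian, Matrix.conjTranspose_eq_transpose_of_trivial] using this
  have hHunit : IsUnit H.det := by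
    have := hH_pos.isUnit.neg
    rw [neg_neg] at this
    exact (Matrix.isUnit_iff_isUnit_det H).1 this
  set T : (𝒵 → ℝ) → ℕ → Ω → ℝ := fun f => subMean Z π I f with hT
  set η : ℕ → Ω → ℝ := fun n ω =>
    ∑ a, ∑ b, |T (fun z => hessian (m z) θ₀ a b) n ω - H a b| with hη
  have hηlim : TendstoInMeasure μ η atTop (fun _ => 0) :=
    TendstoInMeasure.zero_sum _ fun a _ => TendstoInMeasure.zero_sum _ fun b _ => by
      have h := tendstoInMeasure_subMean hZ hlaw hind hπ hI hs hW (hH_sq a b)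
      have e : ∫ z, hessian (m z) θ₀ a b ∂P = H a b := by rw [← hH_eq]; rfl
      rw [e] at h
      exact (tendstoInMeasure_sub_const_iff.2 h).zero_norm
  set Eψ := ∫ z, |ψ z| ∂P with hEψ
  have hψlim : TendstoInMeasure μ (fun n ω => |T (fun z => |ψ z|) n ω - Eψ|) atTop (fun _ => 0) :=
    (tendstoInMeasure_sub_const_iff.2
      (tendstoInMeasure_subMean hZ hlaw hind hπ hI hs hW hψ.abs)).zero_norm
  have hsR : Tendsto (fun n => (s n : ℝ)) atTop atTop := tendsto_natCast_atTop_atTop.comp hs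
  have hsq : Tendsto (fun n => (√(s n : ℝ))⁻¹) atTop (𝓝 0) :=
    (Real.tendsto_sqrt_atTop.comp hsR).inv_tendsto_atTop
  set V := subScore m Z π I θ₀ with hVdef
  have hVs : TendstoInMeasure μ (fun n ω => ‖V n ω‖ * (√(s n : ℝ))⁻¹) atTop (fun _ => 0) :=
    TendstoInMeasure.zero_boundedInProb_mul hV (tendstoInMeasure_zero_of_tendsto hsq)
  have hEψ0 : 0 ≤ Eψ := integral_nonneg fun z => abs_nonneg _
  -- The weighted mean of |ψ| exceeds its expectation by less than 1 with probability tending to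
  -- one, so a deterministic Lipschitz constant is available.
  set L₀ : ℝ := (d : ℝ) ^ 2 * (Eψ + 1) with hL₀
  have hL₀0 : 0 ≤ L₀ := by positivity
  set ρ : ℝ := min (δ / 2) (lam / (4 * (L₀ + 1))) with hρ
  have hρ0 : 0 < ρ := by positivity
  have hρδ : ρ < δ := (min_le_left _ _).trans_lt (by linarith)
  have hL₀ρ : L₀ * ρ ≤ lam / 4 := by
    have h1 : ρ * (4 * (L₀ + 1)) ≤ lam := by
      rw [← le_div_iff₀ (by positivity)]
      exact min_le_right _ _
    nlinarith
  set Ai := Matrix.toEuclideanCLM (𝕜 := ℝ) H⁻¹ with hAi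
  have hAiA : ∀ x, Ai (Matrix.toEuclideanCLM (𝕜 := ℝ) H x) = x := fun x => by
    rw [hAi, ← mul_apply_eq_comp, ← map_mul, Matrix.nonsing_inv_mul _ hHunit, map_one,
      one_apply_eq_self]
  have hglim : TendstoInMeasure μ (fun n ω => ‖V n ω‖ * ((2 / lam * ‖Ai‖) •
      (η n ω + (2 / lam * L₀) • (‖V n ω‖ * (√(s n : ℝ))⁻¹)))) atTop (fun _ => 0) :=
    TendstoInMeasure.zero_boundedInProb_mul hV
      ((hηlim.zero_add (hVs.zero_const_smul _)).zero_const_smul _)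
  -- The three thresholds control the Hessian error, the deviation of the mean of |ψ|, and the
  -- gradient at `θ₀`, as the localization lemma requires.
  refine TendstoInMeasure.zero_of_le_of_small (κ := min (lam / 4) (min 1 (lam * ρ / 2)))
    (by positivity) ((hηlim.zero_add hψlim).zero_add hVs) hglim ?_
  filter_upwards [eventually_ge_atTop 1, hs.eventually_ge_atTop 1] with n hn hsn
  have hn0 : (0 : ℝ) < n := by exact_mod_cast hn
  have hs0 : (0 : ℝ) < s n := by exact_mod_cast hsn
  have hr0 : (0 : ℝ) < √(s n) := Real.sqrt_pos.2 hs0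
  filter_upwards [ae_draws_lt hZ hπ hI hn, ae_forall_pos hπ, hθsub n] with ω hω hpos hsub hsmall
  have hη0 : 0 ≤ η n ω := Finset.sum_nonneg fun a _ => Finset.sum_nonneg fun b _ => abs_nonneg _
  have hVn0 : 0 ≤ ‖V n ω‖ * (√(s n : ℝ))⁻¹ := by positivity
  have hψ0 := abs_nonneg (T (fun z => |ψ z|) n ω - Eψ)
  rw [abs_of_nonneg (by positivity), lt_min_iff, lt_min_iff] at hsmall
  obtain ⟨hs1, hs2, hs3⟩ := hsmall
  set w : Fin (s n) → ℝ := fun j => ((n : ℝ) * s n * π n (I n j ω) ω)⁻¹ with hw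
  have hw0 : ∀ j, 0 ≤ w j := fun j => by
    have := hpos n _ (hω j)
    positivity
  have hobj : subObj m Z π s I n ω = fun θ => ∑ j, w j * m (Z (I n j ω) ω) θ := by
    funext θ
    exact Finset.sum_congr rfl fun j _ => by rw [div_eq_inv_mul]
  have hVω : V n ω = √(s n) • ∑ j, w j • gradient (m (Z (I n j ω) ω)) θ₀ := subScore_eq hω
  set S := ∑ j, w j • gradient (m (Z (I n j ω) ω)) θ₀ with hS
  have hSV : ‖S‖ = ‖V n ω‖ * (√(s n : ℝ))⁻¹ := by
    rw [hVω, norm_smul, Real.norm_of_nonneg hr0.le]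
    field_simp
  have hψT : ∑ j, w j * |ψ (Z (I n j ω) ω)| = T (fun z => |ψ z|) n ω := rfl
  have hψL : (d : ℝ) ^ 2 * ∑ j, w j * |ψ (Z (I n j ω) ω)| ≤ L₀ := by
    rw [hψT, hL₀]
    have := le_abs_self (T (fun z => |ψ z|) n ω - Eψ)
    gcongr
    linarith
  have key := norm_argmax_weightedSum_sub_le (m := m) (Θ := Θ) (w := w)
    (z := fun j => Z (I n j ω) ω) (θ₀ := θ₀) (θ₁ := θsub n ω) (ψ := ψ) (H := H) (δ := δ) (ρ := ρ)
    (lam := lam) hconc hw0 (hconc (Z 0 ω)).1 hball hθ₀ hm_diff hH_lip hHsymm hlam hlamH hsub.1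
    (hobj ▸ hsub.2) (le_of_lt (show η n ω < lam / 4 by linarith)) hρ0 hρδ
    ((mul_le_mul_of_nonneg_right hψL hρ0.le).trans hL₀ρ) (by rw [← hS, hSV]; linarith)
  obtain ⟨hk1, hk2⟩ := key
  rw [← hS] at hk1 hk2
  set h := θsub n ω - θ₀ with hh
  have hk3 : ‖S + Matrix.toEuclideanCLM (𝕜 := ℝ) H h‖ ≤ (η n ω + L₀ * ‖h‖) * ‖h‖ := by
    refine hk2.trans ?_
    gcongr
    exact le_rfl
  have e : √(s n) • h + Ai (V n ω) = √(s n) • Ai (S + Matrix.toEuclideanCLM (𝕜 := ℝ) H h) := by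
    rw [map_add, hAiA, hVω, map_smul, ← smul_add, add_comm]
  rw [e, norm_smul, Real.norm_of_nonneg hr0.le]
  rw [hSV] at hk1
  have hk4 : ‖S + Matrix.toEuclideanCLM (𝕜 := ℝ) H h‖
      ≤ (η n ω + L₀ * (2 / lam * (‖V n ω‖ * (√(s n : ℝ))⁻¹)))
        * (2 / lam * (‖V n ω‖ * (√(s n : ℝ))⁻¹)) := by
    refine hk3.trans ?_
    gcongr
  -- The outer factor √s cancels one factor 1/√s. What remains is the O_P(1) score norm times an
  -- o_P(1) quantity.
  have halg : ∀ r a e L κ v ri : ℝ, r * ri = 1 →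
      r * (a * ((e + L * (κ * (v * ri))) * (κ * (v * ri))))
        = v * ((κ * a) * (e + (κ * L) * (v * ri))) := fun r a e L κ v ri h => by
    linear_combination (a * (e + L * (κ * (v * ri))) * κ * v) * h
  calc √(s n) * ‖Ai (S + Matrix.toEuclideanCLM (𝕜 := ℝ) H h)‖
      ≤ √(s n) * (‖Ai‖ * ((η n ω + L₀ * (2 / lam * (‖V n ω‖ * (√(s n : ℝ))⁻¹)))
        * (2 / lam * (‖V n ω‖ * (√(s n : ℝ))⁻¹)))) := by
        gcongr
        exact (Ai.le_opNorm _).trans (by gcongr)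
    _ = _ := by
        simp only [smul_eq_mul]
        exact halg _ _ _ _ _ _ _ (mul_inv_cancel₀ hr0.ne')

end Assembly

end Subsampling

/-! ### The main theorem: Gaussian limit of the Newton step, then Slutsky. -/

theorem theorem1
    {Ω 𝒵 : Type*} [MeasurableSpace Ω] [MeasurableSpace 𝒵]
    (μ : Measure Ω) [IsProbabilityMeasure μ] (P : Measure 𝒵) [IsProbabilityMeasure P]
    {d : ℕ} (m : 𝒵 → EuclideanSpace ℝ (Fin d) → ℝ)
    (Θ : Set (EuclideanSpace ℝ (Fin d))) (θ₀ : EuclideanSpace ℝ (Fin d))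
    -- the data are independent with common law `P`
    (Z : ℕ → Ω → 𝒵) (hZ_meas : ∀ i, Measurable (Z i)) (hZ_law : ∀ i, μ.map (Z i) = P)
    (hZ_indep : iIndepFun Z μ)
    -- subsample sizes
    (s : ℕ → ℕ) (hs_top : Tendsto s atTop atTop) (hs_lt : ∀ᶠ n in atTop, s n < n)
    (c : ℝ) (hc : Tendsto (fun n => (s n : ℝ) / (n : ℝ)) atTop (𝓝 c))
    -- data-dependent subsampling distribution, and subsampling with replacement from it
    (π : ℕ → ℕ → Ω → ℝ) (hπ : IsSubsamplingDistribution μ Z π)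
    (I : (n : ℕ) → Fin (s n) → Ω → ℕ) (hI : IsSampledWithReplacement μ Z π s I)
    -- compact parameter set, true parameter in its interior
    (hΘ : IsCompact Θ) (hθ₀ : θ₀ ∈ interior Θ)
    -- concavity, square integrability, unique population maximizer
    (hconc : ∀ z, ConcaveOn ℝ Θ (m z))
    (hm_sq : ∀ θ ∈ Θ, MemLp (fun z => m z θ) 2 P)
    (hmax : ∀ θ ∈ Θ, θ ≠ θ₀ → popObj P m θ < popObj P m θ₀)
    -- Hessian: existence, definiteness, square integrability, Lipschitz continuity
    (hm_diff : ∀ z, ContDiffOn ℝ 2 (m z) (interior Θ))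
    (hH_pos : (-expHessian P m θ₀).PosDef)
    (hH_sq : ∀ θ ∈ interior Θ, ∀ k l, MemLp (fun z => hessian (m z) θ k l) 2 P)
    (ψ : 𝒵 → ℝ) (hψ : MemLp ψ 2 P)
    (hH_lip : ∀ z, ∀ θ₁ ∈ interior Θ, ∀ θ₂ ∈ interior Θ, ∀ k l,
      |hessian (m z) θ₁ k l - hessian (m z) θ₂ k l| ≤ ψ z * ‖θ₁ - θ₂‖)
    -- gradient: second moment matrix at the true parameter
    (hg_sq : MemLp (fun z => gradient (m z) θ₀) 2 P)
    (hΛ_pos : (Lam P m θ₀).PosDef)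
    -- the full-data estimator, and fourth moments of the gradient near it
    (θhat : ℕ → Ω → EuclideanSpace ℝ (Fin d))
    (hθhat : ∀ n, ∀ᵐ ω ∂μ, θhat n ω ∈ Θ ∧ IsMaxOn (fullObj m Z n ω) Θ (θhat n ω))
    (r : ℝ) (hr : 0 < r)
    (hg_fourth : ∀ θ ∈ interior Θ, BoundedInProb μ fun n ω =>
      Set.indicator (Metric.ball (θhat n ω) r) (fun θ' => gradFourth m Z n ω θ') θ)
    -- `max_i (n π_{n,i})⁻¹ = O_P(1)`
    (hπ_bdd : BoundedInProb μ fun n ω => ⨆ i : Fin n, ((n : ℝ) * π n i ω)⁻¹)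
    -- `Λ_{n,R}(θ₀)` converges in probability to a positive-definite matrix
    (Λπ : Matrix (Fin d) (Fin d) ℝ) (hΛπ_pos : Λπ.PosDef)
    (hΛπ : ∀ k l, TendstoInMeasure μ (fun n ω => LamR m Z π n ω θ₀ k l) atTop
      (fun _ => Λπ k l))
    -- the subsample estimator
    (θsub : ℕ → Ω → EuclideanSpace ℝ (Fin d)) (hθsub_meas : ∀ n, AEMeasurable (θsub n) μ)
    (hθsub : ∀ n, ∀ᵐ ω ∂μ,
      θsub n ω ∈ Θ ∧ IsMaxOn (subObj m Z π s I n ω) Θ (θsub n ω)) :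
    TendstoInDistribution
      (fun n ω => Real.sqrt (s n) • (θsub n ω - θ₀)) atTop
      (id : EuclideanSpace ℝ (Fin d) → EuclideanSpace ℝ (Fin d)) (fun _ => μ)
      (multivariateGaussian 0
        ((hessian (popObj P m) θ₀)⁻¹ * (Λπ + c • Lam P m θ₀) *
          (hessian (popObj P m) θ₀)⁻¹)) := by
  set H := expHessian P m θ₀ with hH
  have hess_eq := hessian_popObj hθ₀ hm_sq hm_diff hH_sq hψ hH_lip hg_sq
  have hg0 := integral_inner_gradient_eq_zero hθ₀ hm_sq hm_diff hH_sq hψ hH_lip hg_sq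
    (fun θ hθ => by
      rcases eq_or_ne θ θ₀ with rfl | hne
      · exact le_refl (popObj P m θ)
      · exact (hmax θ hθ hne).le)
  rw [hess_eq, ← hH]
  have hc0 : 0 ≤ c := ge_of_tendsto' hc fun n => by positivity
  set S := Λπ + c • Lam P m θ₀ with hS
  have hSpos : S.PosSemidef := hΛπ_pos.posSemidef.add (hΛ_pos.posSemidef.smul hc0)
  have hHinv : H⁻¹.transpose = H⁻¹ := by
    have := hH_pos.isHermitian.neg.inv
    rw [neg_neg] at this
    simpa [Matrix.IsHermitian, Matrix.conjTranspose_eq_transpose_of_trivial] using this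
  have hHSH : (H⁻¹ * S * H⁻¹).PosSemidef := by
    have := hSpos.conjTranspose_mul_mul_same H⁻¹
    rwa [Matrix.conjTranspose_eq_transpose_of_trivial, hHinv] at this
  have hVm := aemeasurable_subScore (m := m) (θ₀ := θ₀) hZ_meas hZ_law hπ hI hg_sq
  have hchar := tendsto_integral_exp_inner_subScore hZ_meas hZ_law hZ_indep hπ hI hs_top hc hπ_bdd
    hg_sq hg0 hΛπ_pos.posSemidef hΛπ
  have hVdist : TendstoInDistribution (subScore m Z π I θ₀) atTop
      (id : EuclideanSpace ℝ (Fin d) → EuclideanSpace ℝ (Fin d)) (fun _ => μ)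
      (multivariateGaussian 0 S) := by
    refine tendstoInDistribution_of_charFun hVm fun t => ?_
    rw [charFun_multivariateGaussian hSpos]
    simpa [neg_div] using hchar t
  have hlin := tendstoInMeasure_argmax_add_newtonStep hZ_meas hZ_law hZ_indep hπ hI hs_top hπ_bdd
    hθ₀ hconc hm_diff hH_pos hH.symm (hH_sq θ₀ hθ₀) hψ hH_lip
    (boundedInProb_of_tendstoInDistribution hVdist) hθsub
  set Ai := Matrix.toEuclideanCLM (𝕜 := ℝ) H⁻¹ with hAi
  have hAisymm : ∀ x y, inner ℝ (Ai x) y = inner ℝ x (Ai y) := fun x y => by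
    rw [real_inner_comm, Matrix.inner_toEuclideanCLM, Matrix.inner_toEuclideanCLM,
      Matrix.dotProduct_mulVec, ← Matrix.mulVec_transpose, hHinv, dotProduct_comm]
  have hNewton : TendstoInDistribution (fun n ω => -Ai (subScore m Z π I θ₀ n ω)) atTop
      (id : EuclideanSpace ℝ (Fin d) → EuclideanSpace ℝ (Fin d)) (fun _ => μ)
      (multivariateGaussian 0 (H⁻¹ * S * H⁻¹)) := by
    refine tendstoInDistribution_of_charFun
      (fun n => (Ai.measurable.comp_aemeasurable (hVm n)).neg) fun t => ?_
    rw [charFun_multivariateGaussian hHSH]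
    -- Since `Ai` is symmetric, the characteristic function of the Newton step at `t` is that of the
    -- score at `-Ai t`.
    have h := hchar (-Ai t)
    have e1 : ∀ n ω, inner ℝ (subScore m Z π I θ₀ n ω) (-Ai t)
        = inner ℝ (-Ai (subScore m Z π I θ₀ n ω)) t := fun n ω => by
      rw [inner_neg_right, inner_neg_left, hAisymm]
    have e2 : (-Ai t).ofLp ⬝ᵥ S.mulVec (-Ai t).ofLp
        = t.ofLp ⬝ᵥ (H⁻¹ * S * H⁻¹).mulVec t.ofLp := by
      rw [WithLp.ofLp_neg, Matrix.mulVec_neg, neg_dotProduct_neg, hAi,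
        Matrix.ofLp_toEuclideanCLM, ← Matrix.mulVec_mulVec, ← Matrix.mulVec_mulVec,
        Matrix.dotProduct_mulVec t.ofLp H⁻¹, ← Matrix.mulVec_transpose, hHinv]
    rw [e2] at h
    simp only [e1] at h
    simpa [neg_div] using h
  refine tendstoInDistribution_of_tendstoInMeasure_sub _ _ hNewton ?_
    fun n => ((hθsub_meas n).sub_const θ₀).const_smul √(s n)
  exact hlin.congr_left fun n => ae_of_all _ fun ω => by simp [hAi]
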